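/- Let $d\ge 2$. For $0\ne v\in\mathbb R^d$ put $x\sigma_v=x-2\langle x,v\rangle v/\|v\|^2$. Let $G$ be a finite reflection group on $\mathbb R^d$, generated by the reflections $\sigma_v$, $v\in R_+$, where $R_+$ is a positive system of a reduced root system, and let $\kappa:R_+\to[0,\infty)$ satisfy $\kappa_u=\kappa_v$ whenever $\sigma_u$ and $\sigma_v$ are conjugate in $G$. Put $$h_\kappa(x)=\prod_{v\in R_+}|\langle x,v\rangle|^{\kappa_v},\qquad \lambda_\kappa=\sum_{v\in R_+}\kappa_v+\frac{d-2}{2},\qquad \omega=\int_{\mathbb S^{d-1}}h_\kappa^2\,d\sigma,\qquad \|f\|=\Big(\frac1\omega\int_{\mathbb S^{d-1}}|f|^2h_\kappa^2\,d\sigma\Big)^{1/2},$$ where $d\sigma$ is the surface measure on $\mathbb S^{d-1}$. Let $\nabla_0$ be the spherical gradient (the tangential part of $\nabla$) and $\nabla_{h,0}f=\nabla_0f+\sum_{v\in R_+}\kappa_v\,\frac{f(x)-f(x\sigma_v)}{\langle x,v\rangle}\,v$. Let $W_2^1(\mathbb S^{d-1},h_\kappa^2)$ be the space of real or complex valued $f\in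 L^2(\mathbb S^{d-1},h_\kappa^2)$ for which $\nabla_{h,0}f\in L^2(\mathbb S^{d-1},h_\kappa^2)$ in the weak sense, i.e. there is $F\in L^2(\mathbb S^{d-1},h_\kappa^2)^d$ with $\int F\varphi\, h_\kappa^2d\sigma=-\int f\,[\nabla_{h,0}\varphi-(2\lambda_\kappa+1)x\varphi]\,h_\kappa^2d\sigma$ for all $\varphi\in C^\infty(\mathbb S^{d-1})$. **Theorem.** Let $f\in W_2^1(\mathbb S^{d-1},h_\kappa^2)$ be invariant under $G$ (almost everywhere), with $\int_{\mathbb S^{d-1}}f\,h_\kappa^2\,d\sigma=0$ and $\|f\|=1$. Then the spherical gradient $\nabla_0f$, taken in the sense of distributions on the open set $\{x\in\mathbb S^{d-1}:h_\kappa(x)\ne0\}$ (whose complement has measure zero), exists as a locally integrable function there, lies in $L^2(\mathbb S^{d-1},h_\kappa^2)$, and satisfies $$\Big(\min_{1\le i\le d}\frac1\omega\int_{\mathbb S^{d-1}}(1-x_i)|f(x)|^2h_\kappa^2(x)\,d\sigma\Big)\,\|\nabla_0f\|^2\ \ge\ C_{\kappa,d},\qquad C_{\kappa,d}=2\lambda_\kappa\left(1-\frac{\sqrt{2\lambda_\kappa}}{\sqrt{(\lambda_\kappa+\frac12)^2+2\lambda_\kappa}}\right).$$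 -/

import Mathlib

open MeasureTheory
open scoped InnerProductSpace ContDiff

noncomputable section

namespace DunklSphere

/-- Euclidean space `ℝ^d`. -/
abbrev E (d : ℕ) : Type := EuclideanSpace ℝ (Fin d)

/-- The unit sphere `S^{d-1}` of `ℝ^d`. -/
abbrev Sph (d : ℕ) : Type := Metric.sphere (0 : E d) 1

variable {d : ℕ}

/-! ### Reflection groups, root systems, multiplicity functions -/

/-- The reflection `σ_v x = x - 2 ⟨x, v⟩ v / ‖v‖²` in the hyperplane orthogonal to `v`. -/
def refl (v : E d) : E d ≃ₗᵢ[ℝ] E d := (ℝ ∙ v)ᗮ.reflection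

/-- `refl` is given by the usual formula. -/
theorem refl_apply (v x : E d) : refl v x = x - (2 * ⟪x, v⟫_ℝ / ‖v‖ ^ 2) • v := by
  simp only [refl]
  rw [Submodule.reflection_orthogonal_apply, Submodule.reflection_apply,
    Submodule.starProjection_singleton, real_inner_comm]
  simp only [two_smul, neg_sub, RCLike.ofReal_real_eq_id, id]
  rw [← add_smul]
  congr 2
  ring

/-- A (reduced, not necessarily crystallographic) root system in `ℝ^d`: a finite set of nonzero
vectors that is stable under the reflections in its members and meets every line through `0` in
the empty set or in a pair `{v, -v}`. It need not span `ℝ^d`, and it may be empty. -/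
structure IsRootSystem (R : Finset (E d)) : Prop where
  ne_zero : ∀ v ∈ R, v ≠ 0
  refl_mem : ∀ v ∈ R, ∀ u ∈ R, refl v u ∈ R
  reduced : ∀ v ∈ R, ∀ c : ℝ, c • v ∈ R → c = 1 ∨ c = -1

/-- `Rp` is a positive system of some root system `R`: the part of `R` that lies in an open
half-space whose bounding hyperplane contains no root. -/
def IsPositiveSystem (Rp : Finset (E d)) : Prop :=
  ∃ R : Finset (E d), IsRootSystem R ∧ ∃ u₀ : E d, (∀ v ∈ R, ⟪v, u₀⟫_ℝ ≠ 0) ∧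
    ∀ v, v ∈ Rp ↔ v ∈ R ∧ 0 < ⟪v, u₀⟫_ℝ

/-- The reflection group `G`, generated by the reflections in the positive roots. -/
def reflGroup (Rp : Finset (E d)) : Subgroup (E d ≃ₗᵢ[ℝ] E d) :=
  Subgroup.closure (refl '' (Rp : Set (E d)))

/-- A nonnegative multiplicity function on the positive roots: `κ u = κ v` whenever `σ_u` and
`σ_v` are conjugate in `G`. (Values of `κ` off `Rp` play no role.) -/
structure IsMultiplicity (Rp : Finset (E d)) (κ : E d → ℝ) : Prop where
  nonneg : ∀ v ∈ Rp, 0 ≤ κ v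
  conj : ∀ u ∈ Rp, ∀ v ∈ Rp, (∃ g ∈ reflGroup Rp, g * refl u * g⁻¹ = refl v) → κ u = κ v

/-! ### The weight, the measure and the constants -/

/-- `γ_κ`, the sum of the multiplicities of the positive roots. -/
def gam (Rp : Finset (E d)) (κ : E d → ℝ) : ℝ := ∑ v ∈ Rp, κ v

/-- `λ_κ = γ_κ + (d - 2) / 2`. -/
def lam (Rp : Finset (E d)) (κ : E d → ℝ) : ℝ := gam Rp κ + ((d : ℝ) - 2) / 2

/-- The weight `h_κ(x) = ∏_{v ∈ R₊} |⟨x, v⟩|^{κ_v}`. -/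
def hWeight (Rp : Finset (E d)) (κ : E d → ℝ) (x : E d) : ℝ := ∏ v ∈ Rp, |⟪x, v⟫_ℝ| ^ κ v

/-- The surface measure `dσ` on the sphere. -/
def surf (d : ℕ) : Measure (Sph d) := (volume : Measure (E d)).toSphere

/-- The measure `h_κ² dσ` on the sphere. -/
def wMeas (Rp : Finset (E d)) (κ : E d → ℝ) : Measure (Sph d) :=
  (surf d).withDensity fun x => ENNReal.ofReal (hWeight Rp κ (x : E d) ^ 2)

/-- The normalization constant `ω = ∫ h_κ² dσ`. -/
def omega (Rp : Finset (E d)) (κ : E d → ℝ) : ℝ := ∫ x : Sph d, hWeight Rp κ (x : E d) ^ 2 ∂(surf d)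

/-- The norm `‖f‖ = ((1/ω) ∫ |f|² h_κ² dσ)^{1/2}`, for scalar or vector valued `f`. -/
def wNorm {V : Type*} [NormedAddCommGroup V] (Rp : Finset (E d)) (κ : E d → ℝ)
    (f : Sph d → V) : ℝ :=
  √((omega Rp κ)⁻¹ * ∫ x, ‖f x‖ ^ 2 ∂(wMeas Rp κ))

/-! ### Gradients of smooth functions -/

/-- The spherical gradient `∇₀ φ` at a point `x` of the sphere: the tangential part of `∇ φ`. -/
def sphGrad (φ : E d → ℝ) (x : E d) : E d := gradient φ x - ⟪x, gradient φ x⟫_ℝ • x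

/-- The difference operator `E_v φ(x) = (φ(x) - φ(x σ_v)) / ⟨x, v⟩`. -/
def diffOp (v : E d) (φ : E d → ℝ) (x : E d) : ℝ := (φ x - φ (refl v x)) / ⟪x, v⟫_ℝ

/-- The Dunkl spherical gradient `∇_{h,0} φ = ∇₀ φ + ∑_{v ∈ R₊} κ_v (E_v φ) v`. -/
def dunklSphGrad (Rp : Finset (E d)) (κ : E d → ℝ) (φ : E d → ℝ) (x : E d) : E d :=
  sphGrad φ x + ∑ v ∈ Rp, (κ v * diffOp v φ x) • v

/-! ### Weak gradients, the Sobolev space, invariance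

Smooth functions on the sphere are the restrictions of smooth functions on `ℝ^d`. -/

variable {𝕜 : Type*} [RCLike 𝕜]

/-- `F` is the gradient `∇_{h,0} f` in the weak sense with respect to `h_κ² dσ`, that is, the
integration by parts formula
`∫ F_j φ h_κ² dσ = - ∫ f [(∇_{h,0} φ)_j - (2 λ_κ + 1) x_j φ] h_κ² dσ`
holds for all smooth `φ` and all `j`. (It is used for `f` and `F` in `L²(h_κ² dσ)`, where all
integrands are integrable.) -/
def IsWeakDunklGrad (Rp : Finset (E d)) (κ : E d → ℝ) (f : Sph d → 𝕜)
    (F : Sph d → EuclideanSpace 𝕜 (Fin d)) : Prop :=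
  ∀ φ : E d → ℝ, ContDiff ℝ ∞ φ → ∀ j : Fin d,
    ∫ x : Sph d, φ (x : E d) • F x j ∂(wMeas Rp κ) =
      - ∫ x : Sph d, (dunklSphGrad Rp κ φ (x : E d) j
          - (2 * lam Rp κ + 1) * (x : E d) j * φ (x : E d)) • f x ∂(wMeas Rp κ)

/-- The weighted Sobolev space `W_2^1(S^{d-1}, h_κ²)`: functions `f ∈ L²(h_κ² dσ)` with
`∇_{h,0} f ∈ L²(h_κ² dσ)`. -/
def MemSobolev (Rp : Finset (E d)) (κ : E d → ℝ) (f : Sph d → 𝕜) : Prop :=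
  MemLp f 2 (wMeas Rp κ) ∧
    ∃ F : Sph d → EuclideanSpace 𝕜 (Fin d), MemLp F 2 (wMeas Rp κ) ∧ IsWeakDunklGrad Rp κ f F

/-- `Ψ` is the spherical gradient `∇₀ f` in the sense of distributions on the open subset
`{h_κ ≠ 0}` of the sphere, whose complement is a null set (functions in `L²(h_κ² dσ)` need not be
locally integrable near the zeros of `h_κ`):
`∫ Ψ_j φ dσ = - ∫ f [(∇₀ φ)_j - (d - 1) x_j φ] dσ`
for all smooth `φ` supported in `{h_κ ≠ 0}` and all `j`. -/
def IsWeakSphGrad (Rp : Finset (E d)) (κ : E d → ℝ) (f : Sph d → 𝕜)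
    (Ψ : Sph d → EuclideanSpace 𝕜 (Fin d)) : Prop :=
  LocallyIntegrableOn Ψ {x : Sph d | hWeight Rp κ (x : E d) ≠ 0} (surf d) ∧
  ∀ φ : E d → ℝ, ContDiff ℝ ∞ φ → tsupport φ ⊆ {x : E d | hWeight Rp κ x ≠ 0} → ∀ j : Fin d,
    ∫ x : Sph d, φ (x : E d) • Ψ x j ∂(surf d) =
      - ∫ x : Sph d, (sphGrad φ (x : E d) j
          - ((d : ℝ) - 1) * (x : E d) j * φ (x : E d)) • f x ∂(surf d)

/-- The action of an orthogonal transformation on the sphere. -/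
def act (g : E d ≃ₗᵢ[ℝ] E d) (x : Sph d) : Sph d := ⟨g x, by simp⟩

/-- Invariance of (the almost everywhere class of) `f` under the reflection group. -/
def IsGInvariant (Rp : Finset (E d)) (f : Sph d → 𝕜) : Prop :=
  ∀ g ∈ reflGroup Rp, ∀ᵐ x ∂(surf d), f (act g x) = f x

/-- The constant `C_{κ,d} = 2 λ (1 - √(2 λ) / √((λ + 1/2)² + 2 λ))` with `λ = λ_κ`. -/
def uncertaintyConst (Rp : Finset (E d)) (κ : E d → ℝ) : ℝ :=
  2 * lam Rp κ *
    (1 - √(2 * lam Rp κ) / √((lam Rp κ + 1 / 2) ^ 2 + 2 * lam Rp κ))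

end DunklSphere

end

open DunklSphere

/-! ### Reflections and the invariance of the weighted measure -/

namespace DunklSphere

variable {d : ℕ} {Rp : Finset (E d)} {κ : E d → ℝ}

/-! Put `N = ‖∇₀f‖²`, `α = ω⁻¹ ∫ x_i |f|² h_κ² dσ` and `λ = λ_κ`. The theorem follows from two
inequalities: the Poincaré inequality `2λ ≤ N` and the uncertainty inequality `(λ + 1/2)² α² ≤ N (1
- α²)`. The first bounds `(1 - α) N` well for small `α`, the second for large `α`. They balance at
`α = √(2λ) / √((λ + 1/2)² + 2λ)`, where both give the constant (`uncertainty_scalar`).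

Everything rests on the identity `∫ ⟨∇_{h,0} φ, w⟩ h_κ² = (2λ + 1) ∫ ⟨x, w⟩ φ h_κ²` on the sphere
(`integral_dunklSphGrad`). It comes from `∫ (T_w Ψ) h_κ² dx = 0` on `ℝ^d`, with `T_w` the Dunkl
operators, applied to `Ψ(x) = ρ(‖x‖) φ(x / ‖x‖)`. For smooth invariant `p` the choice `φ = p²` has
no difference terms, and Cauchy–Schwarz against the tangential part of the `i`-th basis vector,
whose squared length is `1 - x_i²`, gives the uncertainty inequality (`uncertainty_smooth`).

The Poincaré inequality is spectral. On invariant polynomials of degree at most `m` the Dunkl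
Laplacian of the sphere is multiplication by `-m (m + 2λ)` modulo lower degree
(`exists_dunklLaplacian`). Hence the orthogonal projections of an invariant function to polynomials
of increasing degree have orthogonal increments, and also the gradients of these increments are
orthogonal. Mean zero removes degree `0`, and in every degree `m ≥ 1` the factor `m (m + 2λ)` is at
least `2λ`.

The same projections replace mollification for Sobolev functions: they are smooth and invariant,
converge in `L²`, and their energy never exceeds that of the weak gradient, so both inequalities
pass to the limit (`poincare_and_uncertainty`). Finally, for invariant `f` the weak Dunkl gradient
is the distributional spherical gradient where `h_κ ≠ 0` (test with `ψ / h_κ²`), and that gradient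
is unique. -/

theorem refl_refl (v x : E d) : refl v (refl v x) = x :=
  Submodule.reflection_reflection _ _

theorem refl_mem_reflGroup {v : E d} (hv : v ∈ Rp) : refl v ∈ reflGroup Rp :=
  Subgroup.subset_closure ⟨v, hv, rfl⟩

theorem inner_refl_left (v x y : E d) : ⟪refl v x, y⟫_ℝ = ⟪x, refl v y⟫_ℝ := by
  rw [← (refl v).inner_map_map, refl_refl]

theorem refl_self (v : E d) : refl v v = -v :=
  Submodule.reflection_orthogonalComplement_singleton_eq_neg v

theorem inner_refl_self (v x : E d) : ⟪refl v x, v⟫_ℝ = -⟪x, v⟫_ℝ := by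
  rw [inner_refl_left, refl_self, inner_neg_right]

theorem refl_neg (u : E d) : refl (-u) = refl u := by
  ext1 x
  simp only [refl_apply, inner_neg_right, norm_neg, smul_neg]
  rw [mul_neg, neg_div, neg_smul, neg_neg]

theorem refl_conj (v u : E d) : refl v * refl u * (refl v)⁻¹ = refl (refl v u) := by
  have hinv : (refl v)⁻¹ = refl v := by
    rw [inv_eq_iff_mul_eq_one]
    ext1 x
    exact refl_refl v x
  rw [hinv]
  ext1 x
  change refl v (refl u (refl v x)) = _
  rw [refl_apply u, refl_apply (refl v u), map_sub, refl_refl, map_smul, inner_refl_left,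
    LinearIsometryEquiv.norm_map]

theorem IsPositiveSystem.ne_zero (hRp : IsPositiveSystem Rp) {v : E d} (hv : v ∈ Rp) : v ≠ 0 := by
  obtain ⟨R, hR, u₀, -, h⟩ := hRp
  exact hR.ne_zero v ((h v).1 hv).1

theorem IsPositiveSystem.neg_notMem (hRp : IsPositiveSystem Rp) {v : E d} (hv : v ∈ Rp) :
    -v ∉ Rp := by
  obtain ⟨R, hR, u₀, -, h⟩ := hRp
  intro h'
  have h1 := ((h v).1 hv).2
  have h2 := ((h _).1 h').2
  rw [inner_neg_left] at h2
  linarith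

theorem IsPositiveSystem.refl_mem_or (hRp : IsPositiveSystem Rp) {u v : E d} (hu : u ∈ Rp)
    (hv : v ∈ Rp) : refl v u ∈ Rp ∨ -refl v u ∈ Rp := by
  obtain ⟨R, hR, u₀, h0, h⟩ := hRp
  have h1 := hR.refl_mem v ((h v).1 hv).1 u ((h u).1 hu).1
  rcases lt_or_gt_of_ne (h0 _ h1) with h2 | h2
  · right
    rw [h]
    refine ⟨?_, by rw [inner_neg_left]; linarith⟩
    have := hR.refl_mem _ h1 _ h1
    rwa [refl_self] at this
  · left
    rw [h]
    exact ⟨h1, h2⟩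

open Classical in
/-- The reflection `σ_v` permutes the positive roots up to sign. -/
theorem prod_refl_eq (hRp : IsPositiveSystem Rp) (hκ : IsMultiplicity Rp κ) {v : E d}
    (hv : v ∈ Rp) (Φ : ℝ → ℝ → ℝ) (x : E d) :
    ∏ u ∈ Rp, Φ (κ u) |⟪refl v x, u⟫_ℝ| = ∏ u ∈ Rp, Φ (κ u) |⟪x, u⟫_ℝ| := by
  -- `τ u` is the positive one among `±refl v u`, so `τ` is an involution of the positive roots. It
  -- preserves `κ` since the reflections in `u` and `τ u` are conjugate by `refl v`; the absolute
  -- values hide the sign.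
  set τ : E d → E d := fun u => if refl v u ∈ Rp then refl v u else -refl v u with hτ
  have hmem : ∀ u ∈ Rp, τ u ∈ Rp := fun u hu => by
    by_cases h : refl v u ∈ Rp
    · simp [hτ, h]
    · simpa [hτ, h] using (hRp.refl_mem_or hu hv).resolve_left h
  have hinvol : ∀ u ∈ Rp, τ (τ u) = u := fun u hu => by
    by_cases h : refl v u ∈ Rp
    · simp [hτ, h, refl_refl, hu]
    · simp [hτ, h, refl_refl, hRp.neg_notMem hu]
  refine Finset.prod_nbij' τ τ hmem hmem hinvol hinvol fun u hu => ?_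
  have hk : κ u = κ (τ u) := by
    refine hκ.conj u hu _ (hmem u hu) ⟨refl v, refl_mem_reflGroup hv, ?_⟩
    rw [refl_conj]
    by_cases h : refl v u ∈ Rp
    · simp [hτ, h]
    · simp [hτ, h, refl_neg]
  have hi : |⟪refl v x, u⟫_ℝ| = |⟪x, τ u⟫_ℝ| := by
    rw [inner_refl_left]
    by_cases h : refl v u ∈ Rp
    · simp [hτ, h]
    · simp [hτ, h, inner_neg_right]
  rw [hk, hi]

theorem hWeight_refl (hRp : IsPositiveSystem Rp) (hκ : IsMultiplicity Rp κ) {v : E d}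
    (hv : v ∈ Rp) (x : E d) : hWeight Rp κ (refl v x) = hWeight Rp κ x :=
  prod_refl_eq hRp hκ hv (fun k t => t ^ k) x

theorem continuous_hWeight (hκ : IsMultiplicity Rp κ) : Continuous (hWeight Rp κ) := by
  refine continuous_finsetProd _ fun v hv => ?_
  exact Continuous.rpow_const (by fun_prop) fun x => Or.inr (hκ.nonneg v hv)

theorem hWeight_smul {r : ℝ} (hr : 0 < r) (x : E d) :
    hWeight Rp κ (r • x) = r ^ gam Rp κ * hWeight Rp κ x := by
  rw [hWeight, hWeight, gam, Real.rpow_sum_of_pos hr, ← Finset.prod_mul_distrib]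
  refine Finset.prod_congr rfl fun v _ => ?_
  rw [real_inner_smul_left, abs_mul, abs_of_pos hr, Real.mul_rpow hr.le (abs_nonneg _)]

theorem gam_nonneg (hκ : IsMultiplicity Rp κ) : 0 ≤ gam Rp κ :=
  Finset.sum_nonneg hκ.nonneg

theorem lam_nonneg (hd : 2 ≤ d) (hκ : IsMultiplicity Rp κ) : 0 ≤ lam Rp κ := by
  have h1 := gam_nonneg hκ
  have h2 : (2 : ℝ) ≤ d := by exact_mod_cast hd
  unfold lam
  linarith

instance : IsFiniteMeasure (surf d) := by unfold surf; infer_instance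

theorem continuous_act (g : E d ≃ₗᵢ[ℝ] E d) : Continuous (act g) :=
  (g.continuous.comp continuous_subtype_val).subtype_mk _

-- Surface measure is a multiple of the volume of the cone over a set, and a linear isometry maps
-- cones to cones and preserves volume.
open scoped Pointwise in
theorem measurePreserving_act_surf (g : E d ≃ₗᵢ[ℝ] E d) :
    MeasurePreserving (act g) (surf d) (surf d) := by
  refine ⟨(continuous_act g).measurable, ?_⟩
  ext s hs
  rw [Measure.map_apply (continuous_act g).measurable hs, surf,
    Measure.toSphere_apply' _ ((continuous_act g).measurable hs), Measure.toSphere_apply' _ hs]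
  congr 1
  have : Set.Ioo (0 : ℝ) 1 • (Subtype.val '' (act g ⁻¹' s) : Set (E d)) =
      g ⁻¹' (Set.Ioo (0 : ℝ) 1 • (Subtype.val '' s : Set (E d))) := by
    ext x
    simp only [Set.mem_smul, Set.mem_image, Set.mem_preimage]
    constructor
    · rintro ⟨r, hr, _, ⟨y, hy, rfl⟩, rfl⟩
      exact ⟨r, hr, _, ⟨act g y, hy, rfl⟩, by simp [act]⟩
    · rintro ⟨r, hr, _, ⟨y, hy, rfl⟩, h⟩
      refine ⟨r, hr, g.symm y, ⟨act g.symm y, ?_, rfl⟩, ?_⟩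
      · have : act g (act g.symm y) = y := Subtype.ext (by simp [act])
        rwa [this]
      · rw [← map_smul, h, g.symm_apply_apply]
  rw [this]
  exact g.measurePreserving.measure_preimage_equiv (f := g.toHomeomorph.toMeasurableEquiv) _

theorem measurable_hWeight (hκ : IsMultiplicity Rp κ) :
    Measurable fun x : Sph d => ENNReal.ofReal (hWeight Rp κ (x : E d) ^ 2) := by
  have := continuous_hWeight hκ
  fun_prop

theorem measurePreserving_act (hRp : IsPositiveSystem Rp) (hκ : IsMultiplicity Rp κ) {v : E d}
    (hv : v ∈ Rp) : MeasurePreserving (act (refl v)) (wMeas Rp κ) (wMeas Rp κ) := by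
  refine ⟨(continuous_act _).measurable, ?_⟩
  ext s hs
  have hm := (continuous_act (refl v)).measurable
  rw [Measure.map_apply hm hs, wMeas, withDensity_apply _ (hm hs), withDensity_apply _ hs,
    ← (measurePreserving_act_surf (refl v)).setLIntegral_comp_preimage hs (measurable_hWeight hκ)]
  refine lintegral_congr fun x => ?_
  simp only [act, hWeight_refl hRp hκ hv]

theorem integral_wMeas {V : Type*} [NormedAddCommGroup V] [NormedSpace ℝ V]
    (hκ : IsMultiplicity Rp κ) (g : Sph d → V) :
    ∫ x, g x ∂(wMeas Rp κ) = ∫ x : Sph d, (hWeight Rp κ (x : E d) ^ 2) • g x ∂(surf d) := by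
  rw [wMeas, integral_withDensity_eq_integral_toReal_smul (measurable_hWeight hκ)
    (Filter.Eventually.of_forall fun _ => ENNReal.ofReal_lt_top)]
  refine integral_congr_ae (Filter.Eventually.of_forall fun x => ?_)
  simp only [ENNReal.toReal_ofReal (sq_nonneg (hWeight Rp κ (x : E d)))]

theorem isFiniteMeasure_wMeas (hκ : IsMultiplicity Rp κ) : IsFiniteMeasure (wMeas Rp κ) := by
  have hc : Continuous fun x : Sph d => hWeight Rp κ (x : E d) ^ 2 :=
    ((continuous_hWeight hκ).comp continuous_subtype_val).pow 2
  exact isFiniteMeasure_withDensity_ofReal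
    (hc.integrable_of_hasCompactSupport (HasCompactSupport.of_compactSpace _)).2

theorem wMeas_absolutelyContinuous : wMeas Rp κ ≪ surf d := withDensity_absolutelyContinuous _ _

theorem ae_hWeight_ne_zero (hκ : IsMultiplicity Rp κ) :
    ∀ᵐ x : Sph d ∂(wMeas Rp κ), hWeight Rp κ (x : E d) ≠ 0 := by
  rw [wMeas, ae_withDensity_iff (measurable_hWeight hκ)]
  refine Filter.Eventually.of_forall fun x hx h => hx ?_
  simp [h]

theorem inner_ne_zero_of_hWeight {x : E d} (hx : hWeight Rp κ x ≠ 0) {v : E d} (hv : v ∈ Rp)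
    (hk : κ v ≠ 0) : ⟪x, v⟫_ℝ ≠ 0 := by
  intro h
  refine hx (Finset.prod_eq_zero hv ?_)
  rw [h, abs_zero, Real.zero_rpow hk]

end DunklSphere

/-! ### Integration by parts for Dunkl operators on `ℝ^d` -/

namespace DunklSphere

variable {d : ℕ} {Rp : Finset (E d)} {κ : E d → ℝ}

open Filter Topology

/-- A smooth approximation of the weight `h_κ²`. -/
noncomputable def smoothWeight (Rp : Finset (E d)) (κ : E d → ℝ) (ε : ℝ) (x : E d) : ℝ :=
  ∏ v ∈ Rp, (|⟪x, v⟫_ℝ| ^ 2 + ε) ^ κ v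

theorem smoothWeight_refl (hRp : IsPositiveSystem Rp) (hκ : IsMultiplicity Rp κ) {v : E d}
    (hv : v ∈ Rp) (ε : ℝ) (x : E d) :
    smoothWeight Rp κ ε (refl v x) = smoothWeight Rp κ ε x :=
  prod_refl_eq hRp hκ hv (fun k t => (t ^ 2 + ε) ^ k) x

theorem smoothWeight_zero (x : E d) : smoothWeight Rp κ 0 x = hWeight Rp κ x ^ 2 := by
  rw [smoothWeight, hWeight, ← Finset.prod_pow]
  refine Finset.prod_congr rfl fun v _ => ?_
  rw [add_zero, ← Real.rpow_natCast, ← Real.rpow_natCast, ← Real.rpow_mul (abs_nonneg _),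
    ← Real.rpow_mul (abs_nonneg _), mul_comm]

theorem continuous_smoothWeight_param (hκ : IsMultiplicity Rp κ) (x : E d) :
    Continuous fun ε => smoothWeight Rp κ ε x := by
  refine continuous_finsetProd _ fun v hv => ?_
  exact Continuous.rpow_const (by fun_prop) fun x => Or.inr (hκ.nonneg v hv)

theorem smoothWeight_nonneg {ε : ℝ} (hε : 0 ≤ ε) (x : E d) : 0 ≤ smoothWeight Rp κ ε x :=
  Finset.prod_nonneg fun _ _ => Real.rpow_nonneg (by positivity) _

theorem smoothWeight_mono (hκ : IsMultiplicity Rp κ) {ε δ : ℝ} (hε : 0 ≤ ε) (h : ε ≤ δ)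
    (x : E d) : smoothWeight Rp κ ε x ≤ smoothWeight Rp κ δ x := by
  refine Finset.prod_le_prod (fun _ _ => Real.rpow_nonneg (by positivity) _) fun v hv => ?_
  exact Real.rpow_le_rpow (by positivity) (by linarith) (hκ.nonneg v hv)

theorem smoothWeight_eq_exp {ε : ℝ} (hε : 0 < ε) (x : E d) :
    smoothWeight Rp κ ε x = Real.exp (∑ v ∈ Rp, Real.log (⟪x, v⟫_ℝ ^ 2 + ε) * κ v) := by
  rw [Real.exp_sum, smoothWeight]
  refine Finset.prod_congr rfl fun v _ => ?_
  rw [sq_abs, Real.rpow_def_of_pos (by positivity)]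

theorem contDiff_smoothWeight {ε : ℝ} (hε : 0 < ε) : ContDiff ℝ ∞ (smoothWeight Rp κ ε) := by
  have : smoothWeight Rp κ ε =
      fun x => Real.exp (∑ v ∈ Rp, Real.log (⟪x, v⟫_ℝ ^ 2 + ε) * κ v) :=
    funext fun x => smoothWeight_eq_exp hε x
  rw [this]
  refine Real.contDiff_exp.comp (ContDiff.sum fun v _ => ?_)
  refine ContDiff.mul (ContDiff.log (((contDiff_id.inner ℝ contDiff_const).pow 2).add contDiff_const) fun x => ?_) contDiff_const
  positivity

theorem fderiv_smoothWeight {ε : ℝ} (hε : 0 < ε) (x w : E d) :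
    fderiv ℝ (smoothWeight Rp κ ε) x w = smoothWeight Rp κ ε x *
      ∑ v ∈ Rp, 2 * (κ v * ⟪w, v⟫_ℝ * (⟪x, v⟫_ℝ / (⟪x, v⟫_ℝ ^ 2 + ε))) := by
  have hd : HasDerivAt (fun t : ℝ => smoothWeight Rp κ ε (x + t • w))
      (fderiv ℝ (smoothWeight Rp κ ε) x w) 0 :=
    (((contDiff_smoothWeight hε).differentiable (by simp)) x).hasFDerivAt.hasLineDerivAt w
  refine hd.unique ?_
  have h1 : ∀ v ∈ Rp, HasDerivAt (fun t : ℝ => Real.log (⟪x + t • w, v⟫_ℝ ^ 2 + ε) * κ v)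
      (2 * (κ v * ⟪w, v⟫_ℝ * (⟪x, v⟫_ℝ / (⟪x, v⟫_ℝ ^ 2 + ε)))) 0 := fun v _ => by
    have h2 : HasDerivAt (fun t : ℝ => ⟪x + t • w, v⟫_ℝ) ⟪w, v⟫_ℝ 0 := by
      simp only [inner_add_left, real_inner_smul_left]
      simpa using ((hasDerivAt_id (0 : ℝ)).mul_const ⟪w, v⟫_ℝ).const_add ⟪x, v⟫_ℝ
    have h3 := (((h2.fun_pow 2).add_const ε).log (by simp; positivity)).mul_const (κ v)
    refine h3.congr_deriv ?_
    simp only [zero_smul, add_zero]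
    ring
  have h4 := (HasDerivAt.fun_sum h1).exp
  simp only [zero_smul, add_zero, ← smoothWeight_eq_exp hε] at h4
  exact h4

/-- On the ball `φ` is Lipschitz, and `x` and `refl v x` lie at distance `2 |⟪x, v⟫| / ‖v‖`, so the
denominator cancels. On the hyperplane itself `diffOp` is `0`, as a division by zero. -/
theorem exists_diffOp_bound {v : E d} (hv : v ≠ 0) {φ : E d → ℝ} (hφ : ContDiff ℝ 1 φ)
    (R : ℝ) : ∃ C, 0 ≤ C ∧ ∀ x ∈ Metric.closedBall (0 : E d) R, |diffOp v φ x| ≤ C := by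
  obtain ⟨K, hK⟩ := (isCompact_closedBall (0 : E d) R).exists_bound_of_continuousOn
    (hφ.continuous_fderiv one_ne_zero).continuousOn
  have hlip := Convex.lipschitzOnWith_of_nnnorm_fderiv_le (f := φ) (C := K.toNNReal)
    (s := Metric.closedBall (0 : E d) R) (fun x _ => hφ.differentiable one_ne_zero x)
    (fun x hx => by
      rw [← NNReal.coe_le_coe]
      exact (hK x hx).trans (Real.le_coe_toNNReal K)) (convex_closedBall _ _)
  refine ⟨K.toNNReal * (2 / ‖v‖), by positivity, fun x hx => ?_⟩
  have hv' : 0 < ‖v‖ := norm_pos_iff.2 hv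
  have hx' : refl v x ∈ Metric.closedBall (0 : E d) R := by
    simpa using hx
  have h1 := hlip.dist_le_mul x hx _ hx'
  have h2 : dist x (refl v x) = 2 / ‖v‖ * |⟪x, v⟫_ℝ| := by
    rw [dist_eq_norm, refl_apply, sub_sub_cancel, norm_smul, Real.norm_eq_abs, abs_div, abs_mul,
      abs_two, abs_of_nonneg (by positivity : 0 ≤ ‖v‖ ^ 2)]
    field_simp
  rw [Real.dist_eq, h2] at h1
  rw [diffOp, abs_div]
  refine div_le_of_le_mul₀ (abs_nonneg _) (by positivity) ?_
  linarith

theorem measurable_diffOp (v : E d) {φ : E d → ℝ} (hφ : Continuous φ) :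
    Measurable (diffOp v φ) := by
  have := (refl v).continuous
  unfold diffOp
  exact Measurable.div (by fun_prop) (by fun_prop)

/-- Ordinary integration by parts moves the derivative to the weight, whose logarithmic derivative
is a sum of terms odd under `refl v`. Averaging each such term with its reflection turns `2 Ψ` into
`Ψ - Ψ ∘ refl v`, a regularized difference operator. -/
theorem integral_smoothWeight_eq_zero (hRp : IsPositiveSystem Rp) (hκ : IsMultiplicity Rp κ)
    {Ψ : E d → ℝ} (hΨ : ContDiff ℝ 1 Ψ) (hc : HasCompactSupport Ψ) (w : E d) {ε : ℝ}
    (hε : 0 < ε) :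
    ∫ x, smoothWeight Rp κ ε x * (fderiv ℝ Ψ x w + ∑ v ∈ Rp, κ v * ⟪w, v⟫_ℝ *
      (⟪x, v⟫_ℝ / (⟪x, v⟫_ℝ ^ 2 + ε) * (Ψ x - Ψ (refl v x)))) = 0 := by
  have hW := contDiff_smoothWeight (Rp := Rp) (κ := κ) hε
  have hWc := hW.continuous
  have hf1 : Continuous fun x => fderiv ℝ Ψ x w :=
    (hΨ.continuous_fderiv one_ne_zero).clm_apply continuous_const
  have hf2 : Continuous fun x => fderiv ℝ (smoothWeight Rp κ ε) x w :=
    (hW.continuous_fderiv (by simp)).clm_apply continuous_const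
  have hcd : HasCompactSupport fun x => fderiv ℝ Ψ x w := hc.fderiv_apply ℝ w
  have hq : ∀ v, Continuous fun x : E d => ⟪x, v⟫_ℝ / (⟪x, v⟫_ℝ ^ 2 + ε) := fun v =>
    Continuous.div (by fun_prop) (by fun_prop) fun x => by positivity
  have hi1 : Integrable fun x => smoothWeight Rp κ ε x * fderiv ℝ Ψ x w :=
    (hWc.mul hf1).integrable_of_hasCompactSupport hcd.mul_left
  have hibp := integral_mul_fderiv_eq_neg_fderiv_mul_of_integrable (μ := (volume : Measure (E d)))
    (f := smoothWeight Rp κ ε) (g := Ψ) (v := w)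
    ((hf2.mul hΨ.continuous).integrable_of_hasCompactSupport hc.mul_left) hi1
    ((hWc.mul hΨ.continuous).integrable_of_hasCompactSupport hc.mul_left)
    (fun x _ => hW.differentiable (by simp) x) (fun x _ => hΨ.differentiable one_ne_zero x)
  set B : E d → E d → ℝ := fun v x => smoothWeight Rp κ ε x * (κ v * ⟪w, v⟫_ℝ *
    (⟪x, v⟫_ℝ / (⟪x, v⟫_ℝ ^ 2 + ε))) * Ψ x with hB
  have hBi : ∀ v, Integrable (B v) := fun v =>
    Continuous.integrable_of_hasCompactSupport
      ((hWc.mul (continuous_const.mul (hq v))).mul hΨ.continuous) hc.mul_left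
  have hBr : ∀ v ∈ Rp, ∀ x, B v (refl v x) = -(smoothWeight Rp κ ε x * (κ v * ⟪w, v⟫_ℝ *
      (⟪x, v⟫_ℝ / (⟪x, v⟫_ℝ ^ 2 + ε))) * Ψ (refl v x)) := fun v hv x => by
    simp only [hB, smoothWeight_refl hRp hκ hv, inner_refl_self, neg_sq]
    ring
  have hBri : ∀ v ∈ Rp, Integrable fun x => B v (refl v x) := fun v _ =>
    ((refl v).measurePreserving.integrable_comp_emb
      (refl v).toHomeomorph.measurableEmbedding).2 (hBi v)
  have hBint : ∀ v ∈ Rp, ∫ x, B v (refl v x) = ∫ x, B v x := fun v _ =>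
    (refl v).measurePreserving.integral_comp (refl v).toHomeomorph.measurableEmbedding (B v)
  have h1 : ∫ x, fderiv ℝ (smoothWeight Rp κ ε) x w * Ψ x = ∑ v ∈ Rp, 2 * ∫ x, B v x := by
    simp_rw [← integral_const_mul]
    rw [← integral_finsetSum _ fun v _ => (hBi v).const_mul 2]
    refine integral_congr_ae (Eventually.of_forall fun x => ?_)
    simp only [fderiv_smoothWeight hε, hB, Finset.mul_sum, Finset.sum_mul]
    refine Finset.sum_congr rfl fun v _ => by ring
  have h2 : ∀ x, smoothWeight Rp κ ε x * (fderiv ℝ Ψ x w + ∑ v ∈ Rp, κ v * ⟪w, v⟫_ℝ *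
      (⟪x, v⟫_ℝ / (⟪x, v⟫_ℝ ^ 2 + ε) * (Ψ x - Ψ (refl v x)))) =
      smoothWeight Rp κ ε x * fderiv ℝ Ψ x w + ∑ v ∈ Rp, (B v x + B v (refl v x)) := fun x => by
    rw [mul_add, Finset.mul_sum]
    congr 1
    refine Finset.sum_congr rfl fun v hv => ?_
    rw [hBr v hv, hB]
    ring
  simp_rw [h2]
  have hadd : ∀ v ∈ Rp, Integrable fun x => B v x + B v (refl v x) := fun v hv =>
    (hBi v).add (hBri v hv)
  rw [integral_add hi1 (integrable_finsetSum _ hadd), hibp, h1,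
    integral_finsetSum _ hadd, neg_add_eq_zero]
  refine Finset.sum_congr rfl fun v hv => ?_
  rw [integral_add (hBi v) (hBri v hv), hBint v hv, two_mul]

/-- Integration by parts for the Dunkl operators: `∫ (T_w Ψ) h_κ² dx = 0`. -/
theorem integral_dunkl_eq_zero (hRp : IsPositiveSystem Rp) (hκ : IsMultiplicity Rp κ)
    {Ψ : E d → ℝ} (hΨ : ContDiff ℝ 1 Ψ) (hc : HasCompactSupport Ψ) (w : E d) :
    ∫ x, hWeight Rp κ x ^ 2 *
      (fderiv ℝ Ψ x w + ∑ v ∈ Rp, κ v * ⟪w, v⟫_ℝ * diffOp v Ψ x) = 0 := by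
  obtain ⟨R, hR⟩ := hc.isCompact.isBounded.subset_closedBall (0 : E d)
  have hsupp : ∀ x ∉ Metric.closedBall (0 : E d) R, Ψ x = 0 := fun x hx =>
    image_eq_zero_of_notMem_tsupport fun h => hx (hR h)
  have hfd : ∀ x ∉ Metric.closedBall (0 : E d) R, fderiv ℝ Ψ x = 0 := fun x hx =>
    image_eq_zero_of_notMem_tsupport fun h => hx (hR (tsupport_fderiv_subset ℝ h))
  have hbd : ∀ v, ∃ C, v ∈ Rp → 0 ≤ C ∧ ∀ x ∈ Metric.closedBall (0 : E d) R,
      |diffOp v Ψ x| ≤ C := fun v => by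
    by_cases hv : v ∈ Rp
    · obtain ⟨C, hC⟩ := exists_diffOp_bound (hRp.ne_zero hv) hΨ R
      exact ⟨C, fun _ => hC⟩
    · exact ⟨0, fun h => absurd h hv⟩
  choose C hC using hbd
  set bound : E d → ℝ := (Metric.closedBall (0 : E d) R).indicator fun x =>
    smoothWeight Rp κ 1 x * (|fderiv ℝ Ψ x w| + ∑ v ∈ Rp, |κ v * ⟪w, v⟫_ℝ| * C v) with hbound
  have hf1 : Continuous fun x => fderiv ℝ Ψ x w :=
    (hΨ.continuous_fderiv one_ne_zero).clm_apply continuous_const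
  have hlim := tendsto_integral_filter_of_dominated_convergence
    (μ := (volume : Measure (E d))) (l := 𝓝[>] (0 : ℝ))
    (F := fun ε x => smoothWeight Rp κ ε x * (fderiv ℝ Ψ x w + ∑ v ∈ Rp, κ v * ⟪w, v⟫_ℝ *
      (⟪x, v⟫_ℝ / (⟪x, v⟫_ℝ ^ 2 + ε) * (Ψ x - Ψ (refl v x)))))
    (f := fun x => hWeight Rp κ x ^ 2 *
      (fderiv ℝ Ψ x w + ∑ v ∈ Rp, κ v * ⟪w, v⟫_ℝ * diffOp v Ψ x)) bound ?_ ?_ ?_ ?_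
  · have h0 : ∀ᶠ ε in 𝓝[>] (0 : ℝ), (∫ x, smoothWeight Rp κ ε x * (fderiv ℝ Ψ x w +
        ∑ v ∈ Rp, κ v * ⟪w, v⟫_ℝ *
        (⟪x, v⟫_ℝ / (⟪x, v⟫_ℝ ^ 2 + ε) * (Ψ x - Ψ (refl v x))))) = 0 := by
      filter_upwards [self_mem_nhdsWithin] with ε hε
      exact integral_smoothWeight_eq_zero hRp hκ hΨ hc w hε
    exact tendsto_nhds_unique (hlim.congr' h0) tendsto_const_nhds
  · filter_upwards [self_mem_nhdsWithin] with ε hε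
    have hε' : 0 < ε := hε
    have hWc := (contDiff_smoothWeight (Rp := Rp) (κ := κ) hε').continuous
    have hΨc := hΨ.continuous
    have hr : ∀ v : E d, Continuous (refl v) := fun v => (refl v).continuous
    refine (hWc.mul (hf1.add (continuous_finsetSum _ fun v _ => ?_))).aestronglyMeasurable
    exact continuous_const.mul ((Continuous.div (by fun_prop) (by fun_prop)
      fun x => by positivity).mul (by fun_prop))
  · filter_upwards [self_mem_nhdsWithin, Ioo_mem_nhdsGT one_pos] with ε hε hε1
    have hε' : 0 < ε := hε
    refine Eventually.of_forall fun x => ?_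
    by_cases hx : x ∈ Metric.closedBall (0 : E d) R
    · rw [hbound, Set.indicator_of_mem hx, norm_mul, Real.norm_of_nonneg
        (smoothWeight_nonneg hε'.le x)]
      refine mul_le_mul (smoothWeight_mono hκ hε'.le hε1.2.le x) ?_ (norm_nonneg _)
        (smoothWeight_nonneg zero_le_one x)
      refine (norm_add_le _ _).trans (add_le_add le_rfl ?_)
      refine (norm_sum_le _ _).trans (Finset.sum_le_sum fun v hv => ?_)
      rw [norm_mul]
      refine mul_le_mul le_rfl (le_trans ?_ ((hC v hv).2 x hx)) (norm_nonneg _) (abs_nonneg _)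
      rw [Real.norm_eq_abs, diffOp, abs_mul, abs_div, abs_div]
      -- The regularized factor satisfies `|t| / (t² + ε) ≤ 1 / |t|` off the hyperplane and is zero
      -- on it.
      by_cases ht : ⟪x, v⟫_ℝ = 0
      · simp [ht]
      rw [div_mul_eq_mul_div, div_le_div_iff₀ (by positivity) (by positivity),
        abs_of_pos (by positivity : 0 < ⟪x, v⟫_ℝ ^ 2 + ε)]
      have : |⟪x, v⟫_ℝ| * |⟪x, v⟫_ℝ| = ⟪x, v⟫_ℝ ^ 2 := by rw [abs_mul_abs_self, sq]
      have h3 := abs_nonneg (Ψ x - Ψ (refl v x))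
      nlinarith
    · have : ∀ v, Ψ (refl v x) = 0 := fun v => hsupp _ (by simpa using hx)
      rw [hbound, Set.indicator_of_notMem hx, hfd x hx, hsupp x hx]
      simp [this]
  · rw [hbound, integrable_indicator_iff measurableSet_closedBall]
    have hWc := (contDiff_smoothWeight (Rp := Rp) (κ := κ) one_pos).continuous
    exact (hWc.mul (hf1.abs.add continuous_const)).continuousOn.integrableOn_compact
      (isCompact_closedBall _ _)
  · refine Eventually.of_forall fun x => ?_
    refine Tendsto.mul ?_ (tendsto_const_nhds.add (tendsto_finsetSum _ fun v _ =>
      tendsto_const_nhds.mul ?_))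
    · rw [← smoothWeight_zero]
      exact ((continuous_smoothWeight_param hκ x).tendsto 0).mono_left nhdsWithin_le_nhds
    · by_cases ht : ⟪x, v⟫_ℝ = 0
      · simp [diffOp, ht]
      have h1 : Tendsto (fun ε : ℝ => ⟪x, v⟫_ℝ / (⟪x, v⟫_ℝ ^ 2 + ε) * (Ψ x - Ψ (refl v x)))
          (𝓝 0) (𝓝 (⟪x, v⟫_ℝ / (⟪x, v⟫_ℝ ^ 2 + 0) * (Ψ x - Ψ (refl v x)))) := by
        refine Tendsto.mul (Tendsto.div tendsto_const_nhds
          (tendsto_const_nhds.add tendsto_id) ?_) tendsto_const_nhds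
        simpa using ht
      have h2 : ⟪x, v⟫_ℝ / (⟪x, v⟫_ℝ ^ 2 + 0) * (Ψ x - Ψ (refl v x)) = diffOp v Ψ x := by
        rw [diffOp, add_zero]
        field_simp
      rw [h2] at h1
      exact h1.mono_left nhdsWithin_le_nhds

end DunklSphere

/-! ### Polar coordinates and integration by parts on the sphere -/

namespace DunklSphere

variable {d : ℕ} {Rp : Finset (E d)} {κ : E d → ℝ}

open Filter Topology

theorem inner_sphGrad (φ : E d → ℝ) (x w : E d) :
    ⟪sphGrad φ x, w⟫_ℝ = fderiv ℝ φ x (w - ⟪x, w⟫_ℝ • x) := by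
  rw [sphGrad, inner_sub_left, real_inner_smul_left, inner_gradient_left, map_sub, map_smul,
    real_inner_comm, inner_gradient_left, smul_eq_mul, mul_comm]

theorem inner_dunklSphGrad (φ : E d → ℝ) (x w : E d) :
    ⟪dunklSphGrad Rp κ φ x, w⟫_ℝ =
      ⟪sphGrad φ x, w⟫_ℝ + ∑ v ∈ Rp, κ v * ⟪w, v⟫_ℝ * diffOp v φ x := by
  rw [dunklSphGrad, inner_add_left, sum_inner]
  congr 1
  refine Finset.sum_congr rfl fun v _ => ?_
  rw [real_inner_smul_left, real_inner_comm]
  ring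

theorem integral_volumeIoiPow (n : ℕ) (c : ℝ → ℝ) :
    ∫ r : Set.Ioi (0 : ℝ), c r ∂(Measure.volumeIoiPow n) = ∫ r in Set.Ioi (0 : ℝ), r ^ n * c r := by
  simp only [Measure.volumeIoiPow, ENNReal.ofReal]
  rw [integral_withDensity_eq_integral_smul,
    integral_subtype_comap measurableSet_Ioi fun a => Real.toNNReal (a ^ n) • c a]
  · refine setIntegral_congr_fun measurableSet_Ioi fun x hx => ?_
    simp only [NNReal.smul_def, Real.coe_toNNReal _ (pow_nonneg (le_of_lt hx) _), smul_eq_mul]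
  · exact (measurable_subtype_coe.pow_const _).real_toNNReal

theorem integrable_volumeIoiPow (n : ℕ) {c : ℝ → ℝ} (hc : Continuous c)
    (hcs : HasCompactSupport c) :
    Integrable (fun r : Set.Ioi (0 : ℝ) => c r) (Measure.volumeIoiPow n) := by
  have h : IntegrableOn (fun r : ℝ => r ^ n * c r) (Set.Ioi 0) :=
    (((continuous_pow n).mul hc).integrable_of_hasCompactSupport hcs.mul_left).integrableOn
  rw [integrableOn_iff_comap_subtypeVal measurableSet_Ioi] at h
  rw [Measure.volumeIoiPow, integrable_withDensity_iff_integrable_smul']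
  · refine h.congr (Eventually.of_forall fun x => ?_)
    have := x.2.out.le
    simp (disch := positivity) [ENNReal.toReal_ofReal]
  · fun_prop
  · simp

/-- The real power is singular only at `0`, where the cutoff `η` vanishes identically. -/
theorem contDiff_rpow_mul {η : ℝ → ℝ} (hη : ContDiff ℝ ∞ η) (h0 : ∀ r < 1, η r = 0) (a : ℝ) :
    ContDiff ℝ ∞ fun r => r ^ a * η r := by
  rw [contDiff_iff_contDiffAt]
  intro r
  by_cases hr : r = 0
  · subst hr
    refine (contDiffAt_const (c := (0 : ℝ))).congr_of_eventuallyEq ?_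
    filter_upwards [Iio_mem_nhds one_pos] with r hr
    rw [h0 r hr, mul_zero]
  · exact (Real.contDiffAt_rpow_const_of_ne hr).mul hη.contDiffAt

/-- Polar coordinates for a function that separates on rays. -/
theorem integral_polar (hd : 0 < d) {I : E d → ℝ} {A B : Sph d → ℝ} {c₁ c₂ : ℝ → ℝ}
    (hA : Integrable A (surf d)) (hB : Integrable B (surf d))
    (hc₁ : Continuous c₁) (hs₁ : HasCompactSupport c₁)
    (hc₂ : Continuous c₂) (hs₂ : HasCompactSupport c₂)
    (hI : ∀ r : ℝ, 0 < r → ∀ θ : Sph d, I (r • (θ : E d)) = A θ * c₁ r + B θ * c₂ r) :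
    ∫ x, I x = (∫ θ, A θ ∂(surf d)) * (∫ r in Set.Ioi (0 : ℝ), r ^ (d - 1) * c₁ r) +
      (∫ θ, B θ ∂(surf d)) * (∫ r in Set.Ioi (0 : ℝ), r ^ (d - 1) * c₂ r) := by
  have : Nontrivial (E d) := by
    have : Nonempty (Fin d) := ⟨⟨0, hd⟩⟩
    infer_instance
  have hfr : Module.finrank ℝ (E d) = d := by simp
  have hmp := (volume : Measure (E d)).measurePreserving_homeomorphUnitSphereProd
  calc ∫ x, I x = ∫ x : ({(0)}ᶜ : Set (E d)), I x ∂((volume : Measure (E d)).comap (↑)) := by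
        rw [integral_subtype_comap (measurableSet_singleton _).compl, restrict_compl_singleton]
    _ = ∫ p, I (p.2.1 • (p.1 : E d)) ∂((volume : Measure (E d)).toSphere.prod
          (.volumeIoiPow (Module.finrank ℝ (E d) - 1))) := by
      rw [← hmp.integral_comp (Homeomorph.measurableEmbedding _)]
      refine integral_congr_ae (Eventually.of_forall fun x => ?_)
      simp only
      rw [← homeomorphUnitSphereProd_symm_apply_coe, Homeomorph.symm_apply_apply]
    _ = ∫ p : Sph d × Set.Ioi (0 : ℝ), A p.1 * c₁ p.2 + B p.1 * c₂ p.2 ∂((surf d).prod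
          (.volumeIoiPow (d - 1))) := by
      rw [hfr]
      exact integral_congr_ae (Eventually.of_forall fun p => hI p.2 p.2.2 p.1)
    _ = _ := by
      rw [integral_add (hA.mul_prod (integrable_volumeIoiPow _ hc₁ hs₁))
        (hB.mul_prod (integrable_volumeIoiPow _ hc₂ hs₂)),
        integral_prod_mul A fun r : Set.Ioi (0 : ℝ) => c₁ r,
        integral_prod_mul B fun r : Set.Ioi (0 : ℝ) => c₂ r,
        integral_volumeIoiPow, integral_volumeIoiPow]

theorem hasDerivAt_norm_line {θ : E d} (hθ : ‖θ‖ = 1) {r : ℝ} (hr : 0 < r) (w : E d) :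
    HasDerivAt (fun t : ℝ => ‖r • θ + t • w‖) ⟪θ, w⟫_ℝ 0 := by
  have hrn : ‖r • θ‖ = r := by rw [norm_smul, hθ, mul_one, Real.norm_of_nonneg hr.le]
  have h0 : HasDerivAt (fun t : ℝ => r • θ + t • w) w 0 := by
    simpa using ((hasDerivAt_id (0 : ℝ)).smul_const w).const_add (r • θ)
  have h1 := h0.norm_sq.sqrt (by simp [hrn, hr.ne'])
  simp only [Real.sqrt_sq (norm_nonneg _)] at h1
  refine h1.congr_deriv ?_
  simp only [zero_smul, add_zero, hrn, real_inner_smul_left]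
  field_simp

/-- The derivative of `x ↦ ρ(‖x‖) φ(x / ‖x‖)`. -/
theorem hasDerivAt_radial {ρ : ℝ → ℝ} (hρ : Differentiable ℝ ρ) {φ : E d → ℝ}
    (hφ : Differentiable ℝ φ) {θ : E d} (hθ : ‖θ‖ = 1) {r : ℝ} (hr : 0 < r) (w : E d) :
    HasDerivAt (fun t : ℝ => ρ ‖r • θ + t • w‖ * φ (‖r • θ + t • w‖⁻¹ • (r • θ + t • w)))
      (deriv ρ r * ⟪θ, w⟫_ℝ * φ θ + ρ r * (r⁻¹ * ⟪sphGrad φ θ, w⟫_ℝ)) 0 := by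
  have hrn : ‖r • θ‖ = r := by rw [norm_smul, hθ, mul_one, Real.norm_of_nonneg hr.le]
  have hN := hasDerivAt_norm_line hθ hr w
  have h0 : HasDerivAt (fun t : ℝ => r • θ + t • w) w 0 := by
    simpa using ((hasDerivAt_id (0 : ℝ)).smul_const w).const_add (r • θ)
  have hρ' : HasDerivAt ρ (deriv ρ r) ‖r • θ + (0 : ℝ) • w‖ := by
    simpa [hrn] using (hρ r).hasDerivAt
  have h1 := hρ'.comp (0 : ℝ) hN
  have h2 := (hN.fun_inv (by simp [hrn, hr.ne'])).fun_smul h0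
  have hθ' : ‖r • θ + (0 : ℝ) • w‖⁻¹ • (r • θ + (0 : ℝ) • w) = θ := by
    rw [zero_smul, add_zero, hrn, smul_smul, inv_mul_cancel₀ hr.ne', one_smul]
  have hφ' : HasFDerivAt φ (fderiv ℝ φ θ)
      (‖r • θ + (0 : ℝ) • w‖⁻¹ • (r • θ + (0 : ℝ) • w)) := by
    rw [hθ']
    exact (hφ θ).hasFDerivAt
  have h3 := hφ'.comp_hasDerivAt (0 : ℝ) h2
  refine (h1.mul h3).congr_deriv ?_
  simp only [Function.comp_apply, zero_smul, add_zero, hrn]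
  have hθ2 : φ (r⁻¹ • r • θ) = φ θ := by
    rw [smul_smul, inv_mul_cancel₀ hr.ne', one_smul]
  rw [hθ2, inner_sphGrad]
  congr 2
  rw [← smul_eq_mul, ← map_smul]
  congr 1
  rw [smul_sub, smul_smul, smul_smul, sub_eq_add_neg, ← neg_smul]
  congr 2
  field_simp

theorem continuous_inner_sphGrad {φ : E d → ℝ} (hφ : ContDiff ℝ 1 φ) (w : E d) :
    Continuous fun x : E d => ⟪sphGrad φ x, w⟫_ℝ := by
  simp only [inner_sphGrad]
  exact (hφ.continuous_fderiv one_ne_zero).clm_apply (by fun_prop)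

theorem integrable_diffOp {v : E d} (hv : v ≠ 0) {φ : E d → ℝ} (hφ : ContDiff ℝ 1 φ)
    (μ : Measure (Sph d)) [IsFiniteMeasure μ] :
    Integrable (fun x : Sph d => diffOp v φ x) μ := by
  obtain ⟨C, -, hC⟩ := exists_diffOp_bound hv hφ 1
  refine Integrable.of_bound
    ((measurable_diffOp v hφ.continuous).comp measurable_subtype_coe).aestronglyMeasurable C
    (Eventually.of_forall fun x => hC x (by simp))

theorem integrable_of_continuous {V : Type*} [NormedAddCommGroup V] {f : Sph d → V}
    (hf : Continuous f) (μ : Measure (Sph d)) [IsFiniteMeasure μ] : Integrable f μ :=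
  hf.integrable_of_hasCompactSupport (HasCompactSupport.of_compactSpace _)

theorem integrable_inner_dunklSphGrad (hRp : IsPositiveSystem Rp)
    {φ : E d → ℝ} (hφ : ContDiff ℝ 1 φ) (w : E d) (μ : Measure (Sph d)) [IsFiniteMeasure μ] :
    Integrable (fun x : Sph d => ⟪dunklSphGrad Rp κ φ x, w⟫_ℝ) μ := by
  simp only [inner_dunklSphGrad]
  refine Integrable.add (integrable_of_continuous
    ((continuous_inner_sphGrad hφ w).comp continuous_subtype_val) μ) ?_
  exact integrable_finsetSum _ fun v hv => (integrable_diffOp (hRp.ne_zero hv) hφ μ).const_mul _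

/-- Integration by parts on the sphere for the Dunkl spherical gradient. -/
theorem integral_dunklSphGrad (hd : 0 < d) (hRp : IsPositiveSystem Rp)
    (hκ : IsMultiplicity Rp κ) {φ : E d → ℝ} (hφ : ContDiff ℝ 1 φ) (w : E d) :
    ∫ x : Sph d, ⟪dunklSphGrad Rp κ φ x, w⟫_ℝ ∂(wMeas Rp κ) =
      (2 * lam Rp κ + 1) * ∫ x : Sph d, ⟪(x : E d), w⟫_ℝ * φ x ∂(wMeas Rp κ) := by
  -- The cutoff lives on `[1, 3]`, away from the origin, where neither `‖x‖` nor `x / ‖x‖` is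
  -- smooth.
  let ρ : ContDiffBump (2 : ℝ) := ⟨1 / 2, 1, by norm_num, by norm_num⟩
  have hρs : ContDiff ℝ ∞ ρ := ρ.contDiff
  have hρd : Differentiable ℝ ρ := hρs.differentiable (by simp)
  have hρ0 : ∀ r < 1, ρ r = 0 := fun r hr => by
    refine ρ.zero_of_le_dist ?_
    rw [Real.dist_eq, abs_of_neg (by linarith)]
    change (1 : ℝ) ≤ _
    linarith
  have hρ3 : ∀ r > 3, ρ r = 0 := fun r hr => by
    refine ρ.zero_of_le_dist ?_
    rw [Real.dist_eq, abs_of_pos (by linarith)]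
    change (1 : ℝ) ≤ _
    linarith
  have hρ'0 : ∀ r < 1, deriv ρ r = 0 := fun r hr => by
    have : (ρ : ℝ → ℝ) =ᶠ[𝓝 r] fun _ => 0 := by
      filter_upwards [Iio_mem_nhds hr] with s hs using hρ0 s hs
    rw [this.deriv_eq, deriv_const]
  have hρ' : ContDiff ℝ ∞ (deriv ρ) := hρs.deriv'
  set Ψ : E d → ℝ := fun x => ρ ‖x‖ * φ (‖x‖⁻¹ • x) with hΨ
  have hΨd : ContDiff ℝ 1 Ψ := by
    rw [contDiff_iff_contDiffAt]
    intro x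
    by_cases hx : x = 0
    · subst hx
      refine (contDiffAt_const (c := (0 : ℝ))).congr_of_eventuallyEq ?_
      filter_upwards [Metric.ball_mem_nhds (0 : E d) one_pos] with y hy
      rw [hΨ]
      simp only
      rw [hρ0 _ (by simpa using hy), zero_mul]
    · have h1 : ContDiffAt ℝ 1 (fun y : E d => ‖y‖) x := contDiffAt_norm ℝ hx
      refine ContDiffAt.mul ((hρs.of_le (by simp)).contDiffAt.comp x h1) ?_
      exact hφ.contDiffAt.comp x ((h1.inv (norm_ne_zero_iff.2 hx)).smul contDiffAt_id)
  have hΨc : HasCompactSupport Ψ :=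
    HasCompactSupport.intro (isCompact_closedBall (0 : E d) 3) fun x hx => by
      rw [hΨ]
      simp only
      rw [hρ3 _ (by simpa using hx), zero_mul]
  have hmain := integral_dunkl_eq_zero hRp hκ hΨd hΨc w
  have hg := gam_nonneg hκ
  set γ := gam Rp κ with hγ
  have hfm := isFiniteMeasure_wMeas (d := d) hκ
  have hh : Continuous fun x : Sph d => hWeight Rp κ (x : E d) ^ 2 :=
    ((continuous_hWeight hκ).comp continuous_subtype_val).pow 2
  have hsA : HasCompactSupport fun r : ℝ => r ^ (2 * γ) * deriv ρ r :=
    ρ.hasCompactSupport.deriv.mul_left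
  have hsB : HasCompactSupport fun r : ℝ => r ^ (2 * γ - 1) * ρ r :=
    ρ.hasCompactSupport.mul_left
  have hB : Integrable (fun θ : Sph d => hWeight Rp κ (θ : E d) ^ 2 *
      ⟪dunklSphGrad Rp κ φ θ, w⟫_ℝ) (surf d) := by
    obtain ⟨C, hC⟩ := isCompact_univ.exists_bound_of_continuousOn hh.continuousOn
    exact (integrable_inner_dunklSphGrad hRp hφ w (surf d)).bdd_mul
      (c := C) hh.aestronglyMeasurable (Eventually.of_forall fun x => hC x trivial)
  have hA : Integrable (fun θ : Sph d => hWeight Rp κ (θ : E d) ^ 2 *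
      (⟪(θ : E d), w⟫_ℝ * φ θ)) (surf d) := by
    refine integrable_of_continuous (hh.mul ?_) _
    have := hφ.continuous
    fun_prop
  -- The weight `h_κ²` is homogeneous of degree `2γ`, the angular part of `T_w` of degree `-1`.
  -- Hence on the ray through `θ` the integrand is a combination of `r^(2γ) ρ'(r)` and `r^(2γ-1)
  -- ρ(r)`, with coefficients that depend on `θ` only.
  rw [integral_polar hd hA hB (contDiff_rpow_mul hρ' hρ'0 (2 * γ)).continuous hsA
    (contDiff_rpow_mul hρs hρ0 (2 * γ - 1)).continuous hsB ?_] at hmain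
  · have hd1 : ((d - 1 : ℕ) : ℝ) = (d : ℝ) - 1 := by
      rw [Nat.cast_sub hd, Nat.cast_one]
    have hs : 2 * lam Rp κ + 1 = 2 * γ + ((d : ℝ) - 1) := by
      rw [lam, hγ]
      ring
    set s := 2 * lam Rp κ + 1
    have hk1 : ∫ r in Set.Ioi (0 : ℝ), r ^ (d - 1) * (r ^ (2 * γ) * deriv ρ r) =
        ∫ r in Set.Ioi (0 : ℝ), r ^ s * deriv ρ r := by
      refine setIntegral_congr_fun measurableSet_Ioi fun r hr => ?_
      have hr' : 0 < r := hr
      rw [← mul_assoc, ← Real.rpow_natCast, ← Real.rpow_add hr', hd1, hs, add_comm]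
    have hk2 : ∫ r in Set.Ioi (0 : ℝ), r ^ (d - 1) * (r ^ (2 * γ - 1) * ρ r) =
        ∫ r in Set.Ioi (0 : ℝ), r ^ (s - 1) * ρ r := by
      refine setIntegral_congr_fun measurableSet_Ioi fun r hr => ?_
      have hr' : 0 < r := hr
      rw [← mul_assoc, ← Real.rpow_natCast, ← Real.rpow_add hr', hd1, hs]
      congr 2
      ring
    have hi1 : Integrable fun r : ℝ => r ^ s * deriv ρ r :=
      (contDiff_rpow_mul hρ' hρ'0 s).continuous.integrable_of_hasCompactSupport
        ρ.hasCompactSupport.deriv.mul_left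
    have hi2 : Integrable fun r : ℝ => r ^ (s - 1) * ρ r :=
      (contDiff_rpow_mul hρs hρ0 (s - 1)).continuous.integrable_of_hasCompactSupport
        ρ.hasCompactSupport.mul_left
    -- Radial integration by parts makes both radial factors multiples of one positive integral,
    -- which then cancels; the exponent `s = 2γ + d - 1` is the source of the factor `2λ + 1`.
    have hrel : ∫ r in Set.Ioi (0 : ℝ), r ^ s * deriv ρ r =
        -(s * ∫ r in Set.Ioi (0 : ℝ), r ^ (s - 1) * ρ r) := by
      have h1 := HasCompactSupport.integral_Ioi_deriv_eq
        ((contDiff_rpow_mul hρs hρ0 s).of_le (by simp)) ρ.hasCompactSupport.mul_left 0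
      rw [hρ0 0 one_pos, mul_zero, neg_zero] at h1
      rw [eq_neg_iff_add_eq_zero, ← integral_const_mul,
        ← integral_add hi1.integrableOn (hi2.const_mul s).integrableOn]
      refine Eq.trans ?_ h1
      refine setIntegral_congr_fun measurableSet_Ioi fun r hr => ?_
      have hr' : 0 < r := hr
      have := ((Real.hasDerivAt_rpow_const (p := s) (Or.inl hr'.ne')).mul
        (hρd r).hasDerivAt).deriv
      refine Eq.trans ?_ this.symm
      ring
    have hpos : 0 < ∫ r in Set.Ioi (0 : ℝ), r ^ (s - 1) * ρ r := by
      have hz : ∀ r : ℝ, r ∉ Set.Ioi (0 : ℝ) → r ^ (s - 1) * ρ r = 0 := fun r hr => by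
        have : r ≤ 0 := not_lt.1 hr
        rw [hρ0 r (by linarith), mul_zero]
      rw [setIntegral_eq_integral_of_forall_compl_eq_zero hz]
      refine (contDiff_rpow_mul hρs hρ0 (s - 1)).continuous.integral_pos_of_hasCompactSupport_nonneg_nonzero
        ρ.hasCompactSupport.mul_left (fun r => ?_) (x := 2) ?_
      · by_cases hr : r ∈ Set.Ioi (0 : ℝ)
        · exact mul_nonneg (Real.rpow_nonneg (le_of_lt hr) _) ρ.nonneg
        · exact (hz r hr).ge
      · have h2 : ρ 2 = 1 := ρ.one_of_mem_closedBall (Metric.mem_closedBall_self ρ.rIn_pos.le)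
        rw [h2, mul_one]
        exact (Real.rpow_pos_of_pos two_pos _).ne'
    rw [hk1, hk2, hrel] at hmain
    rw [integral_wMeas hκ, integral_wMeas hκ]
    simp only [smul_eq_mul]
    have hz := mul_right_cancel₀ hpos.ne' (a := ∫ x : Sph d, hWeight Rp κ (x : E d) ^ 2 *
      ⟪dunklSphGrad Rp κ φ x, w⟫_ℝ ∂(surf d)) (c := s * ∫ x : Sph d, hWeight Rp κ (x : E d) ^ 2 *
      (⟪(x : E d), w⟫_ℝ * φ x) ∂(surf d))
    apply hz
    linarith
  · intro r hr θ
    have hθ : ‖(θ : E d)‖ = 1 := by simp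
    have hrn : ∀ y : E d, ‖y‖ = 1 → ‖r • y‖ = r := fun y hy => by
      rw [norm_smul, hy, mul_one, Real.norm_of_nonneg hr.le]
    have hfd : fderiv ℝ Ψ (r • (θ : E d)) w = deriv ρ r * ⟪(θ : E d), w⟫_ℝ * φ θ +
        ρ r * (r⁻¹ * ⟪sphGrad φ θ, w⟫_ℝ) :=
      HasDerivAt.unique ((hΨd.differentiable one_ne_zero _).hasFDerivAt.hasLineDerivAt w)
        (hasDerivAt_radial hρd (hφ.differentiable one_ne_zero) hθ hr w)
    have hΨr : ∀ y : E d, ‖y‖ = 1 → Ψ (r • y) = ρ r * φ y := fun y hy => by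
      rw [hΨ]
      simp only
      rw [hrn y hy, smul_smul, inv_mul_cancel₀ hr.ne', one_smul]
    have hdo : ∀ v, diffOp v Ψ (r • (θ : E d)) = ρ r * (r⁻¹ * diffOp v φ θ) := fun v => by
      rw [diffOp, diffOp, map_smul, hΨr _ hθ, hΨr _ (by simp), real_inner_smul_left]
      field_simp
    rw [hfd, hWeight_smul hr, inner_dunklSphGrad, mul_pow, ← Real.rpow_natCast,
      ← Real.rpow_mul hr.le]
    simp_rw [hdo]
    rw [show gam Rp κ * ((2 : ℕ) : ℝ) = 2 * γ by push_cast; ring, Real.rpow_sub_one hr.ne']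
    have : ∑ v ∈ Rp, κ v * ⟪w, v⟫_ℝ * (ρ r * (r⁻¹ * diffOp v φ θ)) =
        ρ r * (r⁻¹ * ∑ v ∈ Rp, κ v * ⟪w, v⟫_ℝ * diffOp v φ θ) := by
      rw [Finset.mul_sum, Finset.mul_sum]
      exact Finset.sum_congr rfl fun v _ => by ring
    rw [this]
    ring

end DunklSphere

/-! ### Polynomials filtered by degree -/

namespace DunklSphere

variable {d : ℕ} {Rp : Finset (E d)} {κ : E d → ℝ}

/-- The polynomial functions of degree `< m` on `ℝ^d`. -/
noncomputable def polyLT (d : ℕ) : ℕ → Submodule ℝ (E d → ℝ)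
  | 0 => ⊥
  | m + 1 => Submodule.span ℝ {1} ⊔
      ⨆ j : Fin d, (polyLT d m).map (LinearMap.mulLeft ℝ fun x : E d => x j)

theorem one_mem_polyLT (m : ℕ) : (1 : E d → ℝ) ∈ polyLT d (m + 1) := by
  rw [polyLT]
  exact Submodule.mem_sup_left (Submodule.mem_span_singleton_self _)

theorem coord_mul_mem_polyLT {m : ℕ} {q : E d → ℝ} (hq : q ∈ polyLT d m) (j : Fin d) :
    (fun x => x j * q x) ∈ polyLT d (m + 1) := by
  rw [polyLT]
  exact Submodule.mem_sup_right (Submodule.mem_iSup_of_mem j ⟨q, hq, rfl⟩)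

/-- The steps for sums and multiples also receive membership in `polyLT`, since derivatives split
over sums only for differentiable functions. -/
theorem polyLT_succ_induction {m : ℕ} {P : (E d → ℝ) → Prop} (one : P 1)
    (mul : ∀ q ∈ polyLT d m, ∀ j, P fun x => x j * q x)
    (add : ∀ p ∈ polyLT d (m + 1), ∀ q ∈ polyLT d (m + 1), P p → P q → P (p + q))
    (smul : ∀ c : ℝ, ∀ p ∈ polyLT d (m + 1), P p → P (c • p)) {p : E d → ℝ}
    (hp : p ∈ polyLT d (m + 1)) : P p := by
  let S : Submodule ℝ (E d → ℝ) :=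
    { carrier := {p | p ∈ polyLT d (m + 1) ∧ P p}
      zero_mem' := ⟨zero_mem _, by simpa using smul 0 1 (one_mem_polyLT m) one⟩
      add_mem' := fun ha hb => ⟨add_mem ha.1 hb.1, add _ ha.1 _ hb.1 ha.2 hb.2⟩
      smul_mem' := fun c _ ha => ⟨Submodule.smul_mem _ c ha.1, smul c _ ha.1 ha.2⟩ }
  have h : polyLT d (m + 1) ≤ S := by
    conv_lhs => rw [polyLT]
    refine sup_le ?_ (iSup_le fun j => ?_)
    · rw [Submodule.span_singleton_le_iff_mem]
      exact ⟨one_mem_polyLT m, one⟩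
    · rintro _ ⟨q, hq, rfl⟩
      exact ⟨coord_mul_mem_polyLT hq j, mul q hq j⟩
  exact (h hp).2

theorem polyLT_le_succ (m : ℕ) : polyLT d m ≤ polyLT d (m + 1) := by
  induction m with
  | zero => simp [polyLT]
  | succ m ih =>
    intro p hp
    refine polyLT_succ_induction (one_mem_polyLT _) (fun q hq j => ?_)
      (fun p _ q _ hp hq => add_mem hp hq) (fun c p _ hp => Submodule.smul_mem _ c hp) hp
    exact coord_mul_mem_polyLT (ih hq) j

theorem polyLT_mono : Monotone (polyLT d) := monotone_nat_of_le_succ polyLT_le_succ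

theorem finiteDimensional_polyLT (m : ℕ) : FiniteDimensional ℝ (polyLT d m) := by
  induction m with
  | zero => rw [polyLT]; infer_instance
  | succ m ih => rw [polyLT]; infer_instance

theorem contDiff_of_mem_polyLT {m : ℕ} {p : E d → ℝ} (hp : p ∈ polyLT d m) :
    ContDiff ℝ ∞ p := by
  induction m generalizing p with
  | zero =>
    rw [polyLT, Submodule.mem_bot] at hp
    rw [hp]
    exact contDiff_const
  | succ m ih =>
    refine polyLT_succ_induction contDiff_const (fun q hq j => ?_)
      (fun p _ q _ hp hq => hp.add hq) (fun c p _ hp => hp.const_smul c) hp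
    exact ContDiff.mul (by fun_prop) (ih hq)

theorem differentiable_of_mem_polyLT {m : ℕ} {p : E d → ℝ} (hp : p ∈ polyLT d m) :
    Differentiable ℝ p := (contDiff_of_mem_polyLT hp).differentiable (by simp)

theorem inner_eq_sum_coord (x w : E d) : ⟪x, w⟫_ℝ = ∑ j, w j * x j := by
  rw [PiLp.inner_apply]
  rfl

theorem inner_mul_mem_polyLT {m : ℕ} {q : E d → ℝ} (hq : q ∈ polyLT d m) (w : E d) :
    (fun x => ⟪x, w⟫_ℝ * q x) ∈ polyLT d (m + 1) := by
  have : (fun x => ⟪x, w⟫_ℝ * q x) = ∑ j, w j • fun x : E d => x j * q x := by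
    ext x
    rw [Finset.sum_apply, inner_eq_sum_coord, Finset.sum_mul]
    exact Finset.sum_congr rfl fun j _ => by simp [mul_assoc]
  rw [this]
  exact Submodule.sum_mem _ fun j _ => Submodule.smul_mem _ _ (coord_mul_mem_polyLT hq j)

theorem fderiv_coord_mul {q : E d → ℝ} (hq : Differentiable ℝ q) (j : Fin d) (x w : E d) :
    fderiv ℝ (fun x : E d => x j * q x) x w = w j * q x + x j * fderiv ℝ q x w := by
  have h1 : HasFDerivAt (fun x : E d => x j) (EuclideanSpace.proj (𝕜 := ℝ) j) x :=
    (EuclideanSpace.proj (𝕜 := ℝ) j).hasFDerivAt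
  rw [(h1.fun_mul (hq x).hasFDerivAt).fderiv]
  simp
  ring

theorem comp_refl_mem_polyLT {m : ℕ} {p : E d → ℝ} (hp : p ∈ polyLT d m) (v : E d) :
    (fun x => p (refl v x)) ∈ polyLT d m := by
  induction m generalizing p with
  | zero =>
    rw [polyLT, Submodule.mem_bot] at hp ⊢
    rw [hp]
    rfl
  | succ m ih =>
    refine polyLT_succ_induction (P := fun p => (fun x => p (refl v x)) ∈ polyLT d (m + 1))
      (one_mem_polyLT _) (fun q hq j => ?_)
      (fun p _ q _ hp hq => add_mem hp hq) (fun c p _ hp => Submodule.smul_mem _ c hp) hp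
    have := inner_mul_mem_polyLT (ih hq) (refl v (EuclideanSpace.single j 1))
    simpa [← inner_refl_left, EuclideanSpace.inner_single_right] using this

/-- Differentiation lowers the degree. -/
theorem fderiv_mem_polyLT {m : ℕ} {p : E d → ℝ} (hp : p ∈ polyLT d (m + 1)) (w : E d) :
    (fun x => fderiv ℝ p x w) ∈ polyLT d m := by
  induction m generalizing p with
  | zero =>
    refine polyLT_succ_induction (P := fun p => (fun x => fderiv ℝ p x w) ∈ polyLT d 0)
      ?_ (fun q hq j => ?_) (fun p hp q hq h1 h2 => ?_) (fun c p hp h1 => ?_) hp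
    · have : (1 : E d → ℝ) = fun _ => 1 := rfl
      simp only [this, fderiv_const_apply, zero_apply]
      exact zero_mem _
    · rw [polyLT, Submodule.mem_bot] at hq
      subst hq
      simp only [Pi.zero_apply, mul_zero, fderiv_const_apply, zero_apply]
      exact zero_mem _
    · convert add_mem h1 h2 using 1
      ext x
      rw [fderiv_add (differentiable_of_mem_polyLT hp x) (differentiable_of_mem_polyLT hq x)]
      rfl
    · convert Submodule.smul_mem _ c h1 using 1
      ext x
      rw [fderiv_const_smul (differentiable_of_mem_polyLT hp x)]
      rfl
  | succ m ih =>
    refine polyLT_succ_induction (P := fun p => (fun x => fderiv ℝ p x w) ∈ polyLT d (m + 1))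
      ?_ (fun q hq j => ?_) (fun p hp q hq h1 h2 => ?_) (fun c p hp h1 => ?_) hp
    · have : (1 : E d → ℝ) = fun _ => 1 := rfl
      simp only [this, fderiv_const_apply, zero_apply]
      exact zero_mem _
    · simp only [fderiv_coord_mul (differentiable_of_mem_polyLT hq)]
      exact add_mem (Submodule.smul_mem _ (w j) hq) (coord_mul_mem_polyLT (ih hq) j)
    · convert add_mem h1 h2 using 1
      ext x
      rw [fderiv_add (differentiable_of_mem_polyLT hp x) (differentiable_of_mem_polyLT hq x)]
      rfl
    · convert Submodule.smul_mem _ c h1 using 1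
      ext x
      rw [fderiv_const_smul (differentiable_of_mem_polyLT hp x)]
      rfl

/-- The Euler operator multiplies by the degree, modulo lower degree. -/
theorem euler_mem_polyLT {m : ℕ} {p : E d → ℝ} (hp : p ∈ polyLT d (m + 1)) :
    (fun x => fderiv ℝ p x x - m * p x) ∈ polyLT d m := by
  induction m generalizing p with
  | zero =>
    have h := fun w => fderiv_mem_polyLT hp w
    simp only [polyLT, Submodule.mem_bot] at h ⊢
    ext x
    simpa using congrFun (h x) x
  | succ m ih =>
    refine polyLT_succ_induction
      (P := fun p => (fun x => fderiv ℝ p x x - (m + 1 : ℕ) * p x) ∈ polyLT d (m + 1))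
      ?_ (fun q hq j => ?_) (fun p hp q hq h1 h2 => ?_) (fun c p hp h1 => ?_) hp
    · convert Submodule.smul_mem _ (-(m + 1 : ℝ)) (one_mem_polyLT (d := d) m) using 1
      ext x
      have : (1 : E d → ℝ) = fun _ => 1 := rfl
      simp [this]
    · have := coord_mul_mem_polyLT (ih hq) j
      convert this using 1
      ext x
      rw [fderiv_coord_mul (differentiable_of_mem_polyLT hq)]
      push_cast
      ring
    · convert add_mem h1 h2 using 1
      ext x
      rw [fderiv_add (differentiable_of_mem_polyLT hp x) (differentiable_of_mem_polyLT hq x)]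
      simp only [add_apply, Pi.add_apply]
      ring
    · convert Submodule.smul_mem _ c h1 using 1
      ext x
      rw [fderiv_const_smul (differentiable_of_mem_polyLT hp x)]
      simp only [smul_apply, Pi.smul_apply, smul_eq_mul]
      ring

/-- Difference quotients along reflections lower the degree. -/
theorem exists_sub_comp_refl {m : ℕ} {p : E d → ℝ} (hp : p ∈ polyLT d (m + 1)) (v : E d) :
    ∃ r ∈ polyLT d m, ∀ x, p x - p (refl v x) = ⟪x, v⟫_ℝ * r x := by
  induction m generalizing p with
  | zero =>
    refine polyLT_succ_induction
      (P := fun p => ∃ r ∈ polyLT d 0, ∀ x, p x - p (refl v x) = ⟪x, v⟫_ℝ * r x)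
      ⟨0, zero_mem _, by simp⟩ (fun q hq j => ⟨0, zero_mem _, ?_⟩) ?_ ?_ hp
    · rw [polyLT, Submodule.mem_bot] at hq
      simp [hq]
    · rintro p - q - ⟨r, hr, h1⟩ ⟨s, hs, h2⟩
      refine ⟨r + s, add_mem hr hs, fun x => ?_⟩
      simp only [Pi.add_apply]
      linarith [h1 x, h2 x]
    · rintro c p - ⟨r, hr, h1⟩
      refine ⟨c • r, Submodule.smul_mem _ c hr, fun x => ?_⟩
      simp only [Pi.smul_apply, smul_eq_mul]
      linear_combination c * h1 x
  | succ m ih =>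
    refine polyLT_succ_induction
      (P := fun p => ∃ r ∈ polyLT d (m + 1), ∀ x, p x - p (refl v x) = ⟪x, v⟫_ℝ * r x)
      ⟨0, zero_mem _, by simp⟩ (fun q hq j => ?_) ?_ ?_ hp
    · obtain ⟨r, hr, h⟩ := ih hq
      -- Leibniz rule for the difference: `x_j q - (x_j - c v_j) (q ∘ σ_v) = x_j (q - q ∘ σ_v) + c
      -- v_j (q ∘ σ_v)` with `c = 2 ⟪x, v⟫ / ‖v‖²`.
      refine ⟨(fun x => x j * r x) + (2 * v j / ‖v‖ ^ 2) • fun x => q (refl v x),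
        add_mem (coord_mul_mem_polyLT hr j)
          (Submodule.smul_mem _ _ (comp_refl_mem_polyLT hq v)), fun x => ?_⟩
      have hj : (refl v x) j = x j - 2 * ⟪x, v⟫_ℝ / ‖v‖ ^ 2 * v j := by
        rw [refl_apply]
        simp
      simp only [Pi.add_apply, Pi.smul_apply, smul_eq_mul, hj]
      linear_combination x j * h x
    · rintro p - q - ⟨r, hr, h1⟩ ⟨s, hs, h2⟩
      refine ⟨r + s, add_mem hr hs, fun x => ?_⟩
      simp only [Pi.add_apply]
      linarith [h1 x, h2 x]
    · rintro c p - ⟨r, hr, h1⟩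
      refine ⟨c • r, Submodule.smul_mem _ c hr, fun x => ?_⟩
      simp only [Pi.smul_apply, smul_eq_mul]
      linear_combination c * h1 x

end DunklSphere

/-! ### The Dunkl Laplacian of the sphere on polynomials -/

namespace DunklSphere

variable {d : ℕ} {Rp : Finset (E d)} {κ : E d → ℝ}

theorem inner_single_one (x : E d) (j : Fin d) : ⟪x, EuclideanSpace.single j (1 : ℝ)⟫_ℝ = x j := by
  simp [EuclideanSpace.inner_single_right]

theorem sphGrad_apply (φ : E d → ℝ) (x : E d) (j : Fin d) :
    sphGrad φ x j =
      fderiv ℝ φ x (EuclideanSpace.single j 1) - x j * fderiv ℝ φ x x := by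
  rw [← inner_single_one, inner_sphGrad, map_sub, map_smul, inner_single_one, smul_eq_mul]

theorem sum_smul_single (w : E d) : ∑ j, w j • EuclideanSpace.single j (1 : ℝ) = w := by
  have := (EuclideanSpace.basisFun (Fin d) ℝ).sum_repr w
  simpa using this

theorem sum_mul_map_single (L : E d →L[ℝ] ℝ) (w : E d) :
    ∑ j, w j * L (EuclideanSpace.single j 1) = L w := by
  conv_rhs => rw [← sum_smul_single w, map_sum]
  simp

theorem sum_coord_sq {x : E d} (hx : ‖x‖ = 1) : ∑ j, x j * x j = 1 := by
  rw [← inner_eq_sum_coord, real_inner_self_eq_norm_sq, hx, one_pow]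

theorem fderiv_mem_polyLT_self {m : ℕ} {q : E d → ℝ} (hq : q ∈ polyLT d m) (w : E d) :
    (fun x => fderiv ℝ q x w) ∈ polyLT d m :=
  fderiv_mem_polyLT (polyLT_le_succ m hq) w

/-- The Euler remainder of `q` drops one degree and the factor `x j` restores it. For `m = 0` the
real number `m - 1` is negative, but then `q = 0`. -/
theorem coord_mul_euler_mem_polyLT {m : ℕ} {q : E d → ℝ} (hq : q ∈ polyLT d m) (j : Fin d) :
    (fun x => x j * (fderiv ℝ q x x - ((m : ℝ) - 1) * q x)) ∈ polyLT d m := by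
  cases m with
  | zero =>
    rw [polyLT, Submodule.mem_bot] at hq
    subst hq
    have : (fun x : E d => x j * (fderiv ℝ (0 : E d → ℝ) x x - (((0 : ℕ) : ℝ) - 1) *
        (0 : E d → ℝ) x)) = 0 := by
      ext x
      simp
    rw [this]
    exact zero_mem _
  | succ m =>
    have := coord_mul_mem_polyLT (euler_mem_polyLT hq) j
    simpa using this

theorem eulerField_mem_polyLT {m : ℕ} {p : E d → ℝ} (hp : p ∈ polyLT d (m + 1)) :
    (fun x => fderiv ℝ p x x) ∈ polyLT d (m + 1) := by
  convert add_mem (polyLT_le_succ _ (euler_mem_polyLT hp)) (Submodule.smul_mem _ (m : ℝ) hp)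
    using 1
  ext x
  simp

/-- The Laplace–Beltrami operator on polynomials. -/
theorem exists_sum_sphGrad_sphGrad {m : ℕ} {p : E d → ℝ} (hp : p ∈ polyLT d (m + 1)) :
    ∃ r ∈ polyLT d m, ∀ x : E d, ‖x‖ = 1 →
      ∑ j, sphGrad (fun y => sphGrad p y j) x j =
        r x - ((m : ℝ) ^ 2 + ((d : ℝ) - 2) * m) * p x := by
  set b : Fin d → E d := fun j => EuclideanSpace.single j 1 with hb
  set P : Fin d → E d → ℝ := fun j x => fderiv ℝ p x (b j) with hP
  set e : E d → ℝ := fun x => fderiv ℝ p x x with he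
  have hPm : ∀ j, P j ∈ polyLT d m := fun j => fderiv_mem_polyLT hp _
  have hem : e ∈ polyLT d (m + 1) := eulerField_mem_polyLT hp
  have heu : (fun x => e x - m * p x) ∈ polyLT d m := euler_mem_polyLT hp
  -- On the unit sphere the radial derivatives of `e` cancel and the sum equals `Δp - ∑ x_j (x·∇)P_j
  -- - (d - 1) e`. Replacing `(x·∇)P_j` by `(m - 1) P_j` and `e` by `m p` produces the eigenvalue;
  -- the three errors, of lower degree, form the witness.
  refine ⟨∑ j, (fun x => fderiv ℝ (P j) x (b j)) -
    ∑ j, (fun x => x j * (fderiv ℝ (P j) x x - ((m : ℝ) - 1) * P j x)) -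
    ((d : ℝ) + m - 2) • fun x => e x - m * p x, ?_, fun x hx => ?_⟩
  · exact sub_mem (sub_mem (Submodule.sum_mem _ fun j _ => fderiv_mem_polyLT_self (hPm j) _)
      (Submodule.sum_mem _ fun j _ => coord_mul_euler_mem_polyLT (hPm j) j))
      (Submodule.smul_mem _ _ heu)
  · have h1 : ∀ j w, fderiv ℝ (fun y => sphGrad p y j) x w =
        fderiv ℝ (P j) x w - (w j * e x + x j * fderiv ℝ e x w) := fun j w => by
      have hed := differentiable_of_mem_polyLT hem
      rw [← fderiv_coord_mul hed]
      simp only [sphGrad_apply]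
      rw [fderiv_fun_sub (differentiable_of_mem_polyLT (hPm j) x)
        (differentiable_of_mem_polyLT (coord_mul_mem_polyLT hem j) x)]
      rfl
    have h2 : ∀ j, sphGrad (fun y => sphGrad p y j) x j = fderiv ℝ (P j) x (b j) -
        x j * (fderiv ℝ (P j) x x - ((m : ℝ) - 1) * P j x) - ((m : ℝ) - 1) * (x j * P j x)
        - e x - x j * fderiv ℝ e x (b j) + x j * x j * (e x + fderiv ℝ e x x) := fun j => by
      rw [sphGrad_apply, h1, h1]
      have : (EuclideanSpace.single j (1 : ℝ) : E d) j = 1 := by simp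
      rw [this]
      ring
    simp only [h2, Finset.sum_add_distrib, Finset.sum_sub_distrib, ← Finset.mul_sum,
      ← Finset.sum_mul, sum_coord_sq hx, Pi.sub_apply, Pi.smul_apply, Finset.sum_apply,
      smul_eq_mul]
    have h3 : ∑ j, x j * P j x = e x := sum_mul_map_single _ x
    have h4 : ∑ j, x j * fderiv ℝ e x (b j) = fderiv ℝ e x x := sum_mul_map_single _ x
    rw [h3, h4]
    simp
    ring

/-- The difference part of the Dunkl Laplacian on polynomials. -/
theorem exists_sum_diffOp_sphGrad {m : ℕ} {p : E d → ℝ} (hp : p ∈ polyLT d (m + 1))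
    (v : E d) : ∃ r ∈ polyLT d m, ∀ x : E d, ⟪x, v⟫_ℝ ≠ 0 →
      ∑ j, v j * diffOp v (fun y => sphGrad p y j) x = r x - m * (p x + p (refl v x)) := by
  set e : E d → ℝ := fun x => fderiv ℝ p x x with he
  have heu : (fun x => e x - m * p x) ∈ polyLT d m := euler_mem_polyLT hp
  obtain ⟨s, hs, h⟩ := exists_sub_comp_refl (polyLT_le_succ _ (fderiv_mem_polyLT hp v)) v
  -- The `v`-component of the tangential gradient is `∂_v p - ⟪x, v⟫ e`. The factor `⟪x, v⟫` is odd
  -- under the reflection, so its difference quotient contributes `-(e + e ∘ refl v)`, with main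
  -- part `-m (p + p ∘ refl v)`.
  refine ⟨s - (fun x => e x - m * p x) - fun x => e (refl v x) - m * p (refl v x),
    sub_mem (sub_mem hs heu) (comp_refl_mem_polyLT heu v), fun x hx => ?_⟩
  have h1 : ∀ y, ∑ j, v j * sphGrad p y j = fderiv ℝ p y v - ⟪y, v⟫_ℝ * e y := fun y => by
    simp only [sphGrad_apply, mul_sub, Finset.sum_sub_distrib, sum_mul_map_single,
      inner_eq_sum_coord, Finset.sum_mul, he]
    congr 1
    exact Finset.sum_congr rfl fun j _ => by ring
  have h2 : ∑ j, v j * diffOp v (fun y => sphGrad p y j) x =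
      (∑ j, v j * sphGrad p x j - ∑ j, v j * sphGrad p (refl v x) j) / ⟪x, v⟫_ℝ := by
    rw [← Finset.sum_sub_distrib, Finset.sum_div]
    refine Finset.sum_congr rfl fun j _ => ?_
    rw [diffOp]
    ring
  rw [h2, h1, h1, inner_refl_self, div_eq_iff hx]
  simp only [Pi.sub_apply]
  linear_combination h x

/-- The Dunkl Laplacian of the sphere acts on polynomials of degree `m` that are invariant at
`x`, up to lower degree, as multiplication by `-m (m + 2λ)`. -/
theorem exists_dunklLaplacian {m : ℕ} {p : E d → ℝ} (hp : p ∈ polyLT d (m + 1)) :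
    ∃ r ∈ polyLT d m, ∀ x : E d, ‖x‖ = 1 → hWeight Rp κ x ≠ 0 →
      (∀ v ∈ Rp, p (refl v x) = p x) →
      ∑ j, dunklSphGrad Rp κ (fun y => sphGrad p y j) x j =
        r x - m * (m + 2 * lam Rp κ) * p x := by
  obtain ⟨r, hr, h1⟩ := exists_sum_sphGrad_sphGrad hp
  choose s hs h2 using exists_sum_diffOp_sphGrad hp
  refine ⟨r + ∑ v ∈ Rp, κ v • s v, add_mem hr (Submodule.sum_mem _ fun v _ =>
    Submodule.smul_mem _ _ (hs v)), fun x hx hh hinv => ?_⟩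
  have h3 : ∀ j, dunklSphGrad Rp κ (fun y => sphGrad p y j) x j =
      sphGrad (fun y => sphGrad p y j) x j +
        ∑ v ∈ Rp, κ v * (v j * diffOp v (fun y => sphGrad p y j) x) := fun j => by
    rw [← inner_single_one, inner_dunklSphGrad, inner_single_one]
    congr 1
    refine Finset.sum_congr rfl fun v _ => ?_
    rw [real_inner_comm, inner_single_one]
    ring
  simp only [h3, Finset.sum_add_distrib]
  rw [h1 x hx, Finset.sum_comm]
  have h4 : ∀ v ∈ Rp, ∑ j, κ v * (v j * diffOp v (fun y => sphGrad p y j) x) =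
      κ v * s v x - κ v * (2 * m * p x) := fun v hv => by
    rw [← Finset.mul_sum]
    -- A root of multiplicity zero does not enter `h_κ`, so `x` may lie on its hyperplane; its term
    -- has coefficient zero anyway.
    by_cases hk : κ v = 0
    · simp [hk]
    · rw [h2 v x (inner_ne_zero_of_hWeight hh hv hk), hinv v hv]
      ring
  rw [Finset.sum_congr rfl h4, Finset.sum_sub_distrib, ← Finset.sum_mul, lam, gam]
  simp only [Pi.add_apply, Finset.sum_apply, Pi.smul_apply, smul_eq_mul]
  ring

end DunklSphere

/-! ### Density of polynomials and orthogonal projections -/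

namespace DunklSphere

variable {d : ℕ} {Rp : Finset (E d)} {κ : E d → ℝ}

open Filter Topology

theorem continuous_of_mem_polyLT {m : ℕ} {p : E d → ℝ} (hp : p ∈ polyLT d m) :
    Continuous fun x : Sph d => p x :=
  (contDiff_of_mem_polyLT hp).continuous.comp continuous_subtype_val

theorem memLp_of_continuous {V : Type*} [NormedAddCommGroup V] {f : Sph d → V}
    (hf : Continuous f) (μ : Measure (Sph d)) [IsFiniteMeasure μ] : MemLp f 2 μ := by
  obtain ⟨C, hC⟩ := isCompact_univ.exists_bound_of_continuousOn hf.continuousOn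
  exact MemLp.of_bound hf.aestronglyMeasurable C (Eventually.of_forall fun x => hC x trivial)

theorem mul_mem_polyLT {m n : ℕ} {p q : E d → ℝ} (hp : p ∈ polyLT d m) (hq : q ∈ polyLT d n) :
    p * q ∈ polyLT d (m + n) := by
  induction m generalizing p with
  | zero =>
    rw [polyLT, Submodule.mem_bot] at hp
    rw [hp, zero_mul]
    exact zero_mem _
  | succ m ih =>
    refine polyLT_succ_induction (P := fun p => p * q ∈ polyLT d (m + 1 + n)) ?_
      (fun r hr j => ?_) (fun a _ b _ h1 h2 => ?_) (fun c a _ h => ?_) hp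
    · rw [one_mul]
      exact polyLT_mono (by omega) hq
    · have := coord_mul_mem_polyLT (ih hr) j
      rw [add_right_comm]
      convert this using 1
      ext x
      simp [mul_assoc]
    · rw [add_mul]
      exact add_mem h1 h2
    · rw [smul_mul_assoc]
      exact Submodule.smul_mem _ c h

/-- The algebra of polynomial functions on the sphere. -/
noncomputable def sphPoly (d : ℕ) : Subalgebra ℝ C(Sph d, ℝ) where
  carrier := {f | ∃ m, ∃ q ∈ polyLT d m, ∀ x : Sph d, f x = q x}
  mul_mem' := by
    rintro f g ⟨m, q, hq, hf⟩ ⟨n, r, hr, hg⟩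
    exact ⟨m + n, q * r, mul_mem_polyLT hq hr, fun x => by simp [hf, hg]⟩
  add_mem' := by
    rintro f g ⟨m, q, hq, hf⟩ ⟨n, r, hr, hg⟩
    exact ⟨max m n, q + r, add_mem (polyLT_mono (le_max_left _ _) hq)
      (polyLT_mono (le_max_right _ _) hr), fun x => by simp [hf, hg]⟩
  algebraMap_mem' c :=
    ⟨1, c • 1, Submodule.smul_mem _ c (one_mem_polyLT 0), fun x => by simp⟩

theorem separatesPoints_sphPoly : (sphPoly d).SeparatesPoints := by
  intro x y hxy
  have : ∃ j, (x : E d) j ≠ (y : E d) j := by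
    by_contra! h
    exact hxy (Subtype.ext (by ext j; exact h j))
  obtain ⟨j, hj⟩ := this
  refine ⟨fun z : Sph d => (z : E d) j, ⟨⟨fun z : Sph d => (z : E d) j, by fun_prop⟩, ?_, rfl⟩, hj⟩
  exact ⟨2, _, coord_mul_mem_polyLT (one_mem_polyLT 0) j, fun z => by simp⟩

/-- Polynomials are dense in `L²`. -/
theorem exists_poly_near (μ : Measure (Sph d)) [IsFiniteMeasure μ] {g : Sph d → ℝ}
    (hg : MemLp g 2 μ) {ε : ℝ} (hε : 0 < ε) :
    ∃ m, ∃ q ∈ polyLT d m, ∫ x, (g x - q x) ^ 2 ∂μ < ε := by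
  have hM : 0 ≤ μ.real Set.univ := measureReal_nonneg
  set M := μ.real Set.univ
  obtain ⟨f, hf, hfm⟩ := MemLp.exists_boundedContinuous_integral_rpow_sub_le (p := 2) two_pos
    (by simpa using hg) (ε := ε / 4) (by positivity)
  simp only [Real.rpow_two, Real.norm_eq_abs, sq_abs] at hf
  have hfm' : MemLp f 2 μ := by simpa using hfm
  -- Splitting the square costs a factor `2`: the `L²` error contributes at most `ε / 2` and the
  -- uniform one `2 δ² M ≤ ε / 4`. The `M + 1` covers the zero measure.
  set δ := √(ε / (8 * (M + 1))) with hδ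
  have hδpos : 0 < δ := Real.sqrt_pos.2 (by positivity)
  obtain ⟨⟨q', m, q, hq, hqq⟩, hnear⟩ :=
    ContinuousMap.exists_mem_subalgebra_near_continuousMap_of_separatesPoints (sphPoly d)
      separatesPoints_sphPoly f.toContinuousMap δ hδpos
  refine ⟨m, q, hq, ?_⟩
  have hb : ∀ x : Sph d, (f x - q x) ^ 2 ≤ δ ^ 2 := fun x => by
    have h1 := (ContinuousMap.norm_coe_le_norm _ x).trans hnear.le
    have h2 : |q x - f x| ≤ δ := by simpa [hqq] using h1
    rw [← sq_abs, abs_sub_comm]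
    exact pow_le_pow_left₀ (abs_nonneg _) h2 2
  have hi : Integrable (fun x => (g x - f x) ^ 2) μ := (hg.sub hfm').integrable_sq
  have hqL := memLp_of_continuous (continuous_of_mem_polyLT hq) μ
  calc ∫ x, (g x - q x) ^ 2 ∂μ ≤ ∫ x, (2 * (g x - f x) ^ 2 + 2 * δ ^ 2) ∂μ := by
        refine integral_mono (hg.sub hqL).integrable_sq
          ((hi.const_mul 2).add (integrable_const _)) fun x => ?_
        have := hb x
        simp only
        nlinarith [sq_nonneg (g x - f x - (f x - q x))]
    _ = 2 * ∫ x, (g x - f x) ^ 2 ∂μ + M * (2 * δ ^ 2) := by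
        rw [integral_add (hi.const_mul 2) (integrable_const _), integral_const_mul,
          integral_const, smul_eq_mul]
    _ < ε := by
        have h1 : δ ^ 2 = ε / (8 * (M + 1)) := Real.sq_sqrt (by positivity)
        have h2 : M * (2 * δ ^ 2) ≤ ε / 4 := by
          rw [h1, mul_div_assoc', mul_div_assoc', div_le_div_iff₀ (by positivity) (by positivity)]
          nlinarith
        linarith

theorem integrable_mul_of_memLp {μ : Measure (Sph d)} {f g : Sph d → ℝ} (hf : MemLp f 2 μ)
    (hg : MemLp g 2 μ) : Integrable (fun x => f x * g x) μ :=
  hf.integrable_mul hg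

/-- The inclusion of polynomials of degree `< m` in `L²`. -/
noncomputable def polyToLp (μ : Measure (Sph d)) [IsFiniteMeasure μ] (m : ℕ) :
    polyLT d m →ₗ[ℝ] Lp ℝ 2 μ where
  toFun p := (memLp_of_continuous (continuous_of_mem_polyLT p.2) μ).toLp
  map_add' _ _ := rfl
  map_smul' _ _ := rfl

/-- The orthogonal projection of an `L²` function to the polynomials of degree `< m`. -/
theorem exists_poly_proj (μ : Measure (Sph d)) [IsFiniteMeasure μ] {g : Sph d → ℝ}
    (hg : MemLp g 2 μ) (m : ℕ) :
    ∃ p ∈ polyLT d m, ∀ q ∈ polyLT d m, ∫ x, (g x - p x) * q x ∂μ = 0 := by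
  have := finiteDimensional_polyLT (d := d) m
  set W := LinearMap.range (polyToLp μ m)
  obtain ⟨⟨p, hp⟩, hpW⟩ : W.starProjection hg.toLp ∈ W :=
    Submodule.starProjection_apply_mem _ _
  refine ⟨p, hp, fun q hq => ?_⟩
  have h1 : ⟪hg.toLp - W.starProjection hg.toLp, polyToLp μ m ⟨q, hq⟩⟫_ℝ = 0 :=
    Submodule.starProjection_inner_eq_zero _ _ ⟨_, rfl⟩
  rw [← hpW, L2.inner_def] at h1
  rw [← h1]
  refine integral_congr_ae ?_
  have hpL := memLp_of_continuous (continuous_of_mem_polyLT hp) μ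
  have hqL := memLp_of_continuous (continuous_of_mem_polyLT hq) μ
  filter_upwards [Lp.coeFn_sub hg.toLp hpL.toLp, hg.coeFn_toLp, hpL.coeFn_toLp,
    hqL.coeFn_toLp] with x h2 h3 h4 h5
  change _ = ⟪(hg.toLp - hpL.toLp : Lp ℝ 2 μ) x, (hqL.toLp : Lp ℝ 2 μ) x⟫_ℝ
  rw [h2, h5, Pi.sub_apply, h3, h4]
  simp [mul_comm]

/-- The projection of a function invariant under a reflection is invariant, provided that the
reflection preserves the measure. -/
theorem poly_proj_invariant {μ : Measure (Sph d)} [IsFiniteMeasure μ] {g : Sph d → ℝ}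
    (hg : MemLp g 2 μ) {m : ℕ} {p : E d → ℝ} (hp : p ∈ polyLT d m)
    (horth : ∀ q ∈ polyLT d m, ∫ x, (g x - p x) * q x ∂μ = 0) {v : E d}
    (hv : MeasurePreserving (act (refl v)) μ μ) (hinv : ∀ᵐ x ∂μ, g (act (refl v) x) = g x) :
    ∀ᵐ x : Sph d ∂μ, p (refl v x) = p x := by
  -- Uniqueness of the projection: by symmetry `p ∘ refl v` has the same orthogonality as `p`
  -- against `q`, which is odd under the reflection. Hence `q` is orthogonal to itself.
  set q : E d → ℝ := p - fun x => p (refl v x) with hq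
  have hpr := comp_refl_mem_polyLT hp v
  have hqm : q ∈ polyLT d m := sub_mem hp hpr
  have hpL := memLp_of_continuous (continuous_of_mem_polyLT hp) μ
  have hprL := memLp_of_continuous (continuous_of_mem_polyLT hpr) μ
  have hqL := memLp_of_continuous (continuous_of_mem_polyLT hqm) μ
  have hemb : MeasurableEmbedding (act (refl v)) := by
    have hinvol : Function.Involutive (act (refl v)) := fun x =>
      Subtype.ext (refl_refl v (x : E d))
    exact ((MeasurableEquiv.ofInvolutive _ hinvol hv.measurable)).measurableEmbedding
  have h1 := horth q hqm
  have h2 : ∫ x : Sph d, (g x - p (refl v x)) * q x ∂μ = 0 := by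
    rw [← hv.integral_comp hemb] at h1
    rw [← neg_eq_zero, ← integral_neg, ← h1]
    refine integral_congr_ae ?_
    filter_upwards [hinv] with x hx
    rw [hx]
    simp only [hq, act, Pi.sub_apply, refl_refl]
    ring
  have h3 : ∫ x : Sph d, q x * q x ∂μ = 0 := by
    have h4 : ∀ x : Sph d, q x * q x = (g x - p (refl v x)) * q x - (g x - p x) * q x :=
      fun x => by
        simp only [hq, Pi.sub_apply]
        ring
    have h5 : Integrable (fun x : Sph d => (g x - p (refl v x)) * q x) μ :=
      integrable_mul_of_memLp (hg.sub hprL) hqL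
    have h6 : Integrable (fun x : Sph d => (g x - p x) * q x) μ :=
      integrable_mul_of_memLp (hg.sub hpL) hqL
    simp_rw [h4]
    rw [integral_sub h5 h6, h1, h2, sub_zero]
  rw [integral_eq_zero_iff_of_nonneg (fun x => mul_self_nonneg _)
    (integrable_mul_of_memLp hqL hqL)] at h3
  filter_upwards [h3] with x hx
  have : q x = 0 := mul_self_eq_zero.1 hx
  simp only [hq, Pi.sub_apply] at this
  linarith

end DunklSphere

/-! ### Green's formula, and the uncertainty inequality for smooth invariant functions -/

namespace DunklSphere

variable {d : ℕ} {Rp : Finset (E d)} {κ : E d → ℝ}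

open Filter Topology

theorem continuous_sphGrad {φ : E d → ℝ} (hφ : ContDiff ℝ 1 φ) :
    Continuous fun x : Sph d => sphGrad φ x := by
  have h1 : Continuous fun x : E d => gradient φ x :=
    (InnerProductSpace.toDual ℝ (E d)).symm.continuous.comp (hφ.continuous_fderiv one_ne_zero)
  unfold sphGrad
  fun_prop

theorem contDiff_sphGrad_coord {φ : E d → ℝ} (hφ : ContDiff ℝ ∞ φ) (j : Fin d) :
    ContDiff ℝ ∞ fun x => sphGrad φ x j := by
  simp only [sphGrad_apply]
  have h1 : ContDiff ℝ ∞ (fderiv ℝ φ) := hφ.fderiv_right (by simp)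
  exact (h1.clm_apply contDiff_const).sub (ContDiff.mul (by fun_prop) (h1.clm_apply contDiff_id))

theorem sphGrad_mul {p q : E d → ℝ} {x : E d} (hp : DifferentiableAt ℝ p x)
    (hq : DifferentiableAt ℝ q x) (w : E d) : ⟪sphGrad (fun y => p y * q y) x, w⟫_ℝ =
      p x * ⟪sphGrad q x, w⟫_ℝ + q x * ⟪sphGrad p x, w⟫_ℝ := by
  rw [inner_sphGrad, inner_sphGrad, inner_sphGrad, fderiv_fun_mul hp hq]
  rfl

theorem sphGrad_tangent (φ : E d → ℝ) {x : E d} (hx : ‖x‖ = 1) : ⟪sphGrad φ x, x⟫_ℝ = 0 := by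
  rw [inner_sphGrad, real_inner_self_eq_norm_sq, hx]
  simp

/-- Leibniz rule for the Dunkl gradient when one factor is invariant. -/
theorem dunklSphGrad_mul {p q : E d → ℝ} (hp : Differentiable ℝ p) (hq : Differentiable ℝ q)
    {x : E d} (hinv : ∀ v ∈ Rp, p (refl v x) = p x) (w : E d) :
    ⟪dunklSphGrad Rp κ (fun y => p y * q y) x, w⟫_ℝ =
      p x * ⟪dunklSphGrad Rp κ q x, w⟫_ℝ + q x * ⟪sphGrad p x, w⟫_ℝ := by
  rw [inner_dunklSphGrad, inner_dunklSphGrad, sphGrad_mul (hp x) (hq x), mul_add, Finset.mul_sum]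
  have : ∀ v ∈ Rp, κ v * ⟪w, v⟫_ℝ * diffOp v (fun y => p y * q y) x =
      p x * (κ v * ⟪w, v⟫_ℝ * diffOp v q x) := fun v hv => by
    simp only [diffOp, hinv v hv]
    ring
  rw [Finset.sum_congr rfl this]
  ring

theorem ae_forall_invariant {μ : Measure (Sph d)} {p : E d → ℝ}
    (hinv : ∀ v ∈ Rp, ∀ᵐ x : Sph d ∂μ, p (refl v x) = p x) :
    ∀ᵐ x : Sph d ∂μ, ∀ v ∈ Rp, p (refl v x) = p x :=
  (ae_ball_iff Rp.countable_toSet).2 hinv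

/-- The spherical gradient of a smooth invariant function is its weak Dunkl gradient. -/
theorem isWeakDunklGrad_sphGrad (hd : 0 < d) (hRp : IsPositiveSystem Rp)
    (hκ : IsMultiplicity Rp κ) {p : E d → ℝ} (hp : ContDiff ℝ ∞ p)
    (hinv : ∀ v ∈ Rp, ∀ᵐ x : Sph d ∂(wMeas Rp κ), p (refl v x) = p x) :
    IsWeakDunklGrad (𝕜 := ℝ) Rp κ (fun x => p x) (fun x => sphGrad p x) := by
  intro φ hφ j
  have hfm := isFiniteMeasure_wMeas (d := d) hκ
  have hp1 : ContDiff ℝ 1 p := hp.of_le (by simp)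
  have hφ1 : ContDiff ℝ 1 φ := hφ.of_le (by simp)
  set w : E d := EuclideanSpace.single j 1 with hw
  have hmain := integral_dunklSphGrad hd hRp hκ (hp1.mul hφ1) w
  have hpc : Continuous fun x : Sph d => p x := hp.continuous.comp continuous_subtype_val
  have hφc : Continuous fun x : Sph d => φ x := hφ.continuous.comp continuous_subtype_val
  have hD := integrable_inner_dunklSphGrad (κ := κ) hRp hφ1 w (wMeas Rp κ)
  have hpD : Integrable (fun x : Sph d => p x * ⟪dunklSphGrad Rp κ φ x, w⟫_ℝ) (wMeas Rp κ) := by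
    obtain ⟨C, hC⟩ := isCompact_univ.exists_bound_of_continuousOn hpc.continuousOn
    exact hD.bdd_mul (c := C) hpc.aestronglyMeasurable (Eventually.of_forall fun x => hC x trivial)
  have hG : Integrable (fun x : Sph d => φ x * ⟪sphGrad p x, w⟫_ℝ) (wMeas Rp κ) :=
    integrable_of_continuous (hφc.mul ((continuous_inner_sphGrad hp1 w).comp
      continuous_subtype_val)) _
  have hX : Integrable (fun x : Sph d => ⟪(x : E d), w⟫_ℝ * (p x * φ x)) (wMeas Rp κ) :=
    integrable_of_continuous (by fun_prop) _
  have h1 : ∫ x : Sph d, ⟪dunklSphGrad Rp κ (fun y => p y * φ y) x, w⟫_ℝ ∂(wMeas Rp κ) =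
      ∫ x : Sph d, p x * ⟪dunklSphGrad Rp κ φ x, w⟫_ℝ ∂(wMeas Rp κ) +
        ∫ x : Sph d, φ x * ⟪sphGrad p x, w⟫_ℝ ∂(wMeas Rp κ) := by
    rw [← integral_add hpD hG]
    refine integral_congr_ae ?_
    filter_upwards [ae_forall_invariant hinv] with x hx
    exact dunklSphGrad_mul (hp.differentiable (by simp)) (hφ.differentiable (by simp)) hx w
  rw [h1] at hmain
  have h2 : ∫ x : Sph d, (dunklSphGrad Rp κ φ (x : E d) j
          - (2 * lam Rp κ + 1) * (x : E d) j * φ (x : E d)) • p x ∂(wMeas Rp κ) =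
      ∫ x : Sph d, p x * ⟪dunklSphGrad Rp κ φ x, w⟫_ℝ ∂(wMeas Rp κ) -
        (2 * lam Rp κ + 1) * ∫ x : Sph d, ⟪(x : E d), w⟫_ℝ * (p x * φ x) ∂(wMeas Rp κ) := by
    rw [← integral_const_mul, ← integral_sub hpD (hX.const_mul _)]
    refine integral_congr_ae (Eventually.of_forall fun x => ?_)
    simp only [hw, inner_single_one, smul_eq_mul]
    ring
  simp only [smul_eq_mul] at h2 ⊢
  rw [h2]
  simp only [hw, inner_single_one] at hmain ⊢
  linarith

theorem exists_dunklSphGrad_bound (hRp : IsPositiveSystem Rp) {φ : E d → ℝ}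
    (hφ : ContDiff ℝ 1 φ) (w : E d) :
    ∃ C, ∀ x : Sph d, ‖⟪dunklSphGrad Rp κ φ x, w⟫_ℝ‖ ≤ C := by
  have hbd : ∀ v, ∃ C, v ∈ Rp → ∀ x ∈ Metric.closedBall (0 : E d) 1, |diffOp v φ x| ≤ C :=
    fun v => by
      by_cases hv : v ∈ Rp
      · obtain ⟨C, -, hC⟩ := exists_diffOp_bound (hRp.ne_zero hv) hφ 1
        exact ⟨C, fun _ => hC⟩
      · exact ⟨0, fun h => absurd h hv⟩
  choose C hC using hbd
  have hc : Continuous fun x : Sph d => ⟪sphGrad φ x, w⟫_ℝ :=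
    (continuous_inner_sphGrad hφ w).comp continuous_subtype_val
  obtain ⟨K, hK⟩ := isCompact_univ.exists_bound_of_continuousOn hc.continuousOn
  refine ⟨K + ∑ v ∈ Rp, |κ v * ⟪w, v⟫_ℝ| * C v, fun x => ?_⟩
  rw [inner_dunklSphGrad]
  refine (norm_add_le _ _).trans (add_le_add (hK x trivial) ?_)
  refine (norm_sum_le _ _).trans (Finset.sum_le_sum fun v hv => ?_)
  rw [norm_mul]
  exact mul_le_mul le_rfl (hC v hv x (by simp)) (norm_nonneg _) (abs_nonneg _)

theorem integrable_dunkl_integrand (hRp : IsPositiveSystem Rp) {φ : E d → ℝ}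
    (hφ : ContDiff ℝ 1 φ) {μ : Measure (Sph d)} [IsFiniteMeasure μ] {V : Type*}
    [NormedAddCommGroup V] [NormedSpace ℝ V] {g : Sph d → V} (hg : Integrable g μ) (j : Fin d) :
    Integrable (fun x : Sph d => (dunklSphGrad Rp κ φ x j
      - (2 * lam Rp κ + 1) * (x : E d) j * φ x) • g x) μ := by
  obtain ⟨C, hC⟩ := exists_dunklSphGrad_bound (κ := κ) hRp hφ (EuclideanSpace.single j 1)
  have h2 := integrable_inner_dunklSphGrad (κ := κ) hRp hφ (EuclideanSpace.single j 1) μ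
  simp only [inner_single_one] at h2 hC
  have h4 : Continuous fun x : Sph d => (2 * lam Rp κ + 1) * (x : E d) j * φ x := by
    have := hφ.continuous
    fun_prop
  obtain ⟨K, hK⟩ := isCompact_univ.exists_bound_of_continuousOn h4.continuousOn
  exact hg.bdd_smul (C + K) (h2.aestronglyMeasurable.sub h4.aestronglyMeasurable)
    (Eventually.of_forall fun x =>
      (norm_sub_le _ _).trans (add_le_add (hC x) (hK x trivial)))

/-- Green's formula against polynomials of degree `m` that are invariant. -/
theorem exists_green (hRp : IsPositiveSystem Rp) (hκ : IsMultiplicity Rp κ) {m : ℕ}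
    {p : E d → ℝ} (hp : p ∈ polyLT d (m + 1))
    (hinv : ∀ v ∈ Rp, ∀ᵐ x : Sph d ∂(wMeas Rp κ), p (refl v x) = p x) :
    ∃ r ∈ polyLT d m, ∀ (g : Sph d → ℝ) (H : Sph d → E d), MemLp g 2 (wMeas Rp κ) →
      MemLp H 2 (wMeas Rp κ) → IsWeakDunklGrad (𝕜 := ℝ) Rp κ g H →
      ∫ x : Sph d, ⟪H x, sphGrad p x⟫_ℝ ∂(wMeas Rp κ) =
        m * (m + 2 * lam Rp κ) * ∫ x : Sph d, g x * p x ∂(wMeas Rp κ) -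
          ∫ x : Sph d, g x * r x ∂(wMeas Rp κ) := by
  -- The remainder `r` is fixed before `g` and `H`, so that a function and its projection can be
  -- compared through the same formula.
  obtain ⟨r, hr, h⟩ := exists_dunklLaplacian (Rp := Rp) (κ := κ) hp
  refine ⟨r, hr, fun g H hg hH hw => ?_⟩
  have hfm := isFiniteMeasure_wMeas (d := d) hκ
  have hps := contDiff_of_mem_polyLT hp
  have hφ : ∀ j, ContDiff ℝ ∞ fun x => sphGrad p x j := contDiff_sphGrad_coord hps
  have hHj : ∀ j, MemLp (fun x => H x j) 2 (wMeas Rp κ) := fun j => by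
    refine hH.mono ((EuclideanSpace.proj (𝕜 := ℝ) j).continuous.comp_aestronglyMeasurable
      hH.aestronglyMeasurable) (Eventually.of_forall fun x => PiLp.norm_apply_le _ _)
  have hφL : ∀ j, MemLp (fun x : Sph d => sphGrad p x j) 2 (wMeas Rp κ) := fun j =>
    memLp_of_continuous ((hφ j).continuous.comp continuous_subtype_val) _
  have hgi : Integrable g (wMeas Rp κ) := hg.integrable (by norm_num)
  have hDi := fun j => integrable_dunkl_integrand (κ := κ) hRp ((hφ j).of_le (by simp)) hgi j
  simp only [smul_eq_mul] at hDi
  have h1 : ∫ x : Sph d, ⟪H x, sphGrad p x⟫_ℝ ∂(wMeas Rp κ) =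
      ∑ j, ∫ x : Sph d, sphGrad p x j * H x j ∂(wMeas Rp κ) := by
    rw [← integral_finsetSum _ fun j _ => integrable_mul_of_memLp (hφL j) (hHj j)]
    exact integral_congr_ae (Eventually.of_forall fun x => inner_eq_sum_coord _ _)
  have h2 : ∀ j, ∫ x : Sph d, sphGrad p x j * H x j ∂(wMeas Rp κ) =
      -∫ x : Sph d, (dunklSphGrad Rp κ (fun y => sphGrad p y j) x j
      - (2 * lam Rp κ + 1) * (x : E d) j * sphGrad p x j) * g x ∂(wMeas Rp κ) := fun j =>
    hw _ (hφ j) j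
  have hpL := memLp_of_continuous (continuous_of_mem_polyLT hp) (wMeas Rp κ)
  have hrL := memLp_of_continuous (continuous_of_mem_polyLT hr) (wMeas Rp κ)
  rw [h1, Finset.sum_congr rfl fun j _ => h2 j, Finset.sum_neg_distrib,
    ← integral_finsetSum _ fun j _ => hDi j, ← integral_const_mul, ← integral_neg,
    ← integral_sub ((integrable_mul_of_memLp hg hpL).const_mul _) (integrable_mul_of_memLp hg hrL)]
  refine integral_congr_ae ?_
  filter_upwards [ae_forall_invariant hinv, ae_hWeight_ne_zero hκ] with x hx hx'
  have hx1 : ‖(x : E d)‖ = 1 := by simp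
  have h3 := h x hx1 hx' hx
  -- Tangency of the gradient removes the zero-order term with the factor `2λ + 1`.
  have h4 : ∑ j, (x : E d) j * sphGrad p x j = 0 := by
    rw [← inner_eq_sum_coord, sphGrad_tangent p hx1]
  rw [← Finset.sum_mul, Finset.sum_sub_distrib, h3]
  simp only [mul_assoc, ← Finset.mul_sum, h4]
  ring

/-- The uncertainty inequality for smooth invariant functions. -/
theorem uncertainty_smooth (hd : 0 < d) (hRp : IsPositiveSystem Rp)
    (hκ : IsMultiplicity Rp κ) {p : E d → ℝ} (hp : ContDiff ℝ ∞ p)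
    (hinv : ∀ v ∈ Rp, ∀ᵐ x : Sph d ∂(wMeas Rp κ), p (refl v x) = p x) (j : Fin d) :
    ((lam Rp κ + 1 / 2) * ∫ x : Sph d, (x : E d) j * p x ^ 2 ∂(wMeas Rp κ)) ^ 2 ≤
      (∫ x : Sph d, ‖sphGrad p x‖ ^ 2 ∂(wMeas Rp κ)) *
        ∫ x : Sph d, (1 - (x : E d) j ^ 2) * p x ^ 2 ∂(wMeas Rp κ) := by
  have hfm := isFiniteMeasure_wMeas (d := d) hκ
  set w : E d := EuclideanSpace.single j 1 with hw
  have hp1 : ContDiff ℝ 1 p := hp.of_le (by simp)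
  have hpc : Continuous fun x : Sph d => p x := hp.continuous.comp continuous_subtype_val
  have hGc := continuous_sphGrad hp1
  have hmain := integral_dunklSphGrad hd hRp hκ (hp1.mul hp1) w
  have h1 : ∫ x : Sph d, ⟪dunklSphGrad Rp κ (fun y => p y * p y) x, w⟫_ℝ ∂(wMeas Rp κ) =
      2 * ∫ x : Sph d, p x * ⟪sphGrad p x, w⟫_ℝ ∂(wMeas Rp κ) := by
    rw [← integral_const_mul]
    refine integral_congr_ae ?_
    filter_upwards [ae_forall_invariant hinv] with x hx
    have hpd := hp.differentiable (by simp)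
    have hE : ∀ v ∈ Rp, κ v * ⟪w, v⟫_ℝ * diffOp v (fun y => p y * p y) x = 0 := fun v hv => by
      simp [diffOp, hx v hv]
    rw [inner_dunklSphGrad, Finset.sum_congr rfl hE, sphGrad_mul (hpd x) (hpd x)]
    simp
    ring
  have h2 : (lam Rp κ + 1 / 2) * ∫ x : Sph d, (x : E d) j * p x ^ 2 ∂(wMeas Rp κ) =
      ∫ x : Sph d, p x * ⟪sphGrad p x, w⟫_ℝ ∂(wMeas Rp κ) := by
    rw [h1] at hmain
    simp only [hw, inner_single_one] at hmain ⊢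
    simp only [← sq] at hmain
    linarith
  rw [h2]
  -- Cauchy–Schwarz through the discriminant: the quadratic in `t` is the integral of `‖t ∇₀p + p (w
  -- - x_j x)‖²`. The tangential part of `w` may replace `w`, and its squared length is `1 - x_j²`.
  have hquad : ∀ t : ℝ, 0 ≤ (∫ x : Sph d, ‖sphGrad p x‖ ^ 2 ∂(wMeas Rp κ)) * (t * t) +
      (2 * ∫ x : Sph d, p x * ⟪sphGrad p x, w⟫_ℝ ∂(wMeas Rp κ)) * t +
      ∫ x : Sph d, (1 - (x : E d) j ^ 2) * p x ^ 2 ∂(wMeas Rp κ) := fun t => by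
    have hi1 : Integrable (fun x : Sph d => ‖sphGrad p x‖ ^ 2 * (t * t)) (wMeas Rp κ) :=
      integrable_of_continuous (by fun_prop) _
    have hi2 : Integrable (fun x : Sph d => (2 * (p x * ⟪sphGrad p x, w⟫_ℝ)) * t)
        (wMeas Rp κ) := integrable_of_continuous (by fun_prop) _
    have hi3 : Integrable (fun x : Sph d => (1 - (x : E d) j ^ 2) * p x ^ 2)
        (wMeas Rp κ) := integrable_of_continuous (by fun_prop) _
    have hi12 : Integrable (fun x : Sph d => ‖sphGrad p x‖ ^ 2 * (t * t) +
        (2 * (p x * ⟪sphGrad p x, w⟫_ℝ)) * t) (wMeas Rp κ) := hi1.add hi2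
    rw [← integral_mul_const, ← integral_const_mul, ← integral_mul_const,
      ← integral_add hi1 hi2, ← integral_add hi12 hi3]
    refine integral_nonneg fun x => ?_
    have hx1 : ‖(x : E d)‖ = 1 := by simp
    have hn : ‖w - (x : E d) j • (x : E d)‖ ^ 2 = 1 - (x : E d) j ^ 2 := by
      rw [norm_sub_sq_real, norm_smul, hx1, real_inner_smul_right, real_inner_comm,
        inner_single_one]
      simp [hw]
      ring
    have h3 := sq_nonneg ‖t • sphGrad p x + p x • (w - (x : E d) j • (x : E d))‖
    rw [norm_add_sq_real, norm_smul, norm_smul, real_inner_smul_left, real_inner_smul_right,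
      inner_sub_right, real_inner_smul_right, sphGrad_tangent p hx1, mul_pow, mul_pow, hn,
      Real.norm_eq_abs, Real.norm_eq_abs, sq_abs, sq_abs] at h3
    simp only [Pi.zero_apply]
    linarith
  have := discrim_le_zero hquad
  rw [discrim] at this
  linarith

end DunklSphere

/-! ### Poincaré and uncertainty inequalities for real Sobolev functions -/

namespace DunklSphere

variable {d : ℕ} {Rp : Finset (E d)} {κ : E d → ℝ}

open Filter Topology

/-- Pointwise `|q² - g²| ≤ (1/δ + 1)(g - q)² + δ g²` for every `δ > 0`; the last term is made small
first, then `n` large. -/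
theorem tendsto_integral_mul_sq {μ : Measure (Sph d)} [IsFiniteMeasure μ] {g : Sph d → ℝ}
    (hg : MemLp g 2 μ) {q : ℕ → Sph d → ℝ} (hq : ∀ n, MemLp (q n) 2 μ)
    (hlim : Tendsto (fun n => ∫ x, (g x - q n x) ^ 2 ∂μ) atTop (𝓝 0))
    {c : Sph d → ℝ} (hc : Continuous c) (hc1 : ∀ x, |c x| ≤ 1) :
    Tendsto (fun n => ∫ x, c x * q n x ^ 2 ∂μ) atTop (𝓝 (∫ x, c x * g x ^ 2 ∂μ)) := by
  have hci : ∀ {f : Sph d → ℝ}, Integrable f μ → Integrable (fun x => c x * f x) μ :=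
    fun hf => hf.bdd_mul (c := 1) hc.aestronglyMeasurable (Eventually.of_forall hc1)
  have hG : 0 ≤ ∫ x, g x ^ 2 ∂μ := integral_nonneg fun x => sq_nonneg _
  set G := ∫ x, g x ^ 2 ∂μ
  have key : ∀ δ : ℝ, 0 < δ → ∀ n, |∫ x, c x * q n x ^ 2 ∂μ - ∫ x, c x * g x ^ 2 ∂μ| ≤
      (1 / δ + 1) * ∫ x, (g x - q n x) ^ 2 ∂μ + δ * G := fun δ hδ n => by
    have hi1 : Integrable (fun x => (1 / δ + 1) * (g x - q n x) ^ 2) μ :=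
      ((hg.sub (hq n)).integrable_sq).const_mul _
    rw [← integral_sub (hci (hq n).integrable_sq) (hci hg.integrable_sq), ← integral_const_mul,
      ← integral_const_mul, ← integral_add hi1 (hg.integrable_sq.const_mul _)]
    refine (abs_integral_le_integral_abs).trans (integral_mono
      ((hci (hq n).integrable_sq).sub (hci hg.integrable_sq)).abs
      (hi1.add (hg.integrable_sq.const_mul _)) fun x => ?_)
    simp only
    rw [← mul_sub, abs_mul]
    refine (mul_le_of_le_one_left (abs_nonneg _) (hc1 x)).trans ?_
    set u := g x - q n x with hu
    have hq' : q n x = g x - u := by rw [hu]; ring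
    rw [hq']
    have h2 : 1 / δ * u ^ 2 + δ * g x ^ 2 - 2 * |u * g x| = (|u| - δ * |g x|) ^ 2 / δ := by
      rw [← sq_abs u, ← sq_abs (g x), abs_mul]
      field_simp
      ring
    have h3 : 0 ≤ (|u| - δ * |g x|) ^ 2 / δ := by positivity
    have h4 : |(g x - u) ^ 2 - g x ^ 2| ≤ u ^ 2 + 2 * |u * g x| := by
      rw [show (g x - u) ^ 2 - g x ^ 2 = u ^ 2 - 2 * (u * g x) by ring]
      refine (abs_sub _ _).trans ?_
      rw [abs_of_nonneg (sq_nonneg u), abs_mul, abs_two]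
    linarith
  rw [Metric.tendsto_atTop]
  intro ε hε
  set δ := ε / (2 * (G + 1)) with hδ
  have hδ0 : 0 < δ := by positivity
  have hδG : δ * G < ε / 2 := by
    rw [hδ, div_mul_eq_mul_div, div_lt_div_iff₀ (by positivity) two_pos]
    nlinarith
  have h1 : Tendsto (fun n => (1 / δ + 1) * ∫ x, (g x - q n x) ^ 2 ∂μ) atTop (𝓝 0) := by
    simpa using hlim.const_mul (1 / δ + 1)
  obtain ⟨N, hN⟩ := eventually_atTop.1 (h1.eventually (gt_mem_nhds (half_pos hε)))
  refine ⟨N, fun n hn => ?_⟩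
  rw [Real.dist_eq]
  linarith [key δ hδ0 n, hN n hn]

theorem two_mul_inner_le {V : Type*} [NormedAddCommGroup V] [InnerProductSpace ℝ V] (a b : V) :
    ⟪a, b⟫_ℝ ≤ (‖a‖ ^ 2 + ‖b‖ ^ 2) / 2 := by
  have := norm_sub_sq_real a b
  have := sq_nonneg ‖a - b‖
  linarith

theorem integrable_inner_of_memLp {V : Type*} [NormedAddCommGroup V] [InnerProductSpace ℝ V]
    {μ : Measure (Sph d)} {f g : Sph d → V} (hf : MemLp f 2 μ) (hg : MemLp g 2 μ) :
    Integrable (fun x => ⟪f x, g x⟫_ℝ) μ := by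
  refine ((hf.integrable_norm_pow two_ne_zero).add
    (hg.integrable_norm_pow two_ne_zero)).mono'
    (hf.aestronglyMeasurable.inner hg.aestronglyMeasurable) (Eventually.of_forall fun x => ?_)
  refine (norm_inner_le_norm _ _).trans ?_
  simp only [Pi.add_apply]
  nlinarith [sq_nonneg (‖f x‖ - ‖g x‖), sq_nonneg (‖f x‖ + ‖g x‖)]

/-- The Poincaré inequality and the uncertainty inequality for real invariant Sobolev functions. -/
theorem poincare_and_uncertainty (hd : 2 ≤ d) (hRp : IsPositiveSystem Rp)
    (hκ : IsMultiplicity Rp κ) {g : Sph d → ℝ} {H : Sph d → E d} (hg : MemLp g 2 (wMeas Rp κ))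
    (hH : MemLp H 2 (wMeas Rp κ)) (hw : IsWeakDunklGrad (𝕜 := ℝ) Rp κ g H)
    (hinv : ∀ v ∈ Rp, ∀ᵐ x ∂(wMeas Rp κ), g (act (refl v) x) = g x)
    (hmean : ∫ x, g x ∂(wMeas Rp κ) = 0) :
    2 * lam Rp κ * ∫ x, g x ^ 2 ∂(wMeas Rp κ) ≤ ∫ x, ‖H x‖ ^ 2 ∂(wMeas Rp κ) ∧
    ∀ j, ((lam Rp κ + 1 / 2) * ∫ x : Sph d, (x : E d) j * g x ^ 2 ∂(wMeas Rp κ)) ^ 2 ≤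
      (∫ x, ‖H x‖ ^ 2 ∂(wMeas Rp κ)) *
        ∫ x : Sph d, (1 - (x : E d) j ^ 2) * g x ^ 2 ∂(wMeas Rp κ) := by
  have hfm := isFiniteMeasure_wMeas (d := d) hκ
  have hd0 : 0 < d := by omega
  have hlam := lam_nonneg hd hκ
  set μ := wMeas Rp κ with hμ
  choose p hp horth using exists_poly_proj μ hg
  have hpL := fun m => memLp_of_continuous (continuous_of_mem_polyLT (hp m)) μ
  have hpinv : ∀ m, ∀ v ∈ Rp, ∀ᵐ x : Sph d ∂μ, p m (refl v x) = p m x := fun m v hv =>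
    poly_proj_invariant hg (hp m) (horth m) (measurePreserving_act hRp hκ hv) (hinv v hv)
  have hps := fun m => contDiff_of_mem_polyLT (hp m)
  have hGc := fun m => continuous_sphGrad ((hps m).of_le (by simp : (1 : WithTop ℕ∞) ≤ ∞))
  have hGL := fun m => memLp_of_continuous (hGc m) μ
  have hpw := fun m => isWeakDunklGrad_sphGrad hd0 hRp hκ (hps m) (hpinv m)
  -- the defining relation of the projection, as an equality of integrals
  have hproj : ∀ m, ∀ q ∈ polyLT d m, ∫ x, g x * q x ∂μ = ∫ x, p m x * q x ∂μ := fun m q hq => by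
    have hqL := memLp_of_continuous (continuous_of_mem_polyLT hq) μ
    have h1 := horth m q hq
    simp only [sub_mul] at h1
    rw [integral_sub (integrable_mul_of_memLp hg hqL)
      (integrable_mul_of_memLp (hpL m) hqL)] at h1
    linarith
  set e : ℕ → ℝ := fun m => ∫ x : Sph d, ‖sphGrad (p m) x‖ ^ 2 ∂μ with he
  set n : ℕ → ℝ := fun m => ∫ x : Sph d, p m x ^ 2 ∂μ with hn
  have hHint : Integrable (fun x => ‖H x‖ ^ 2) μ := hH.integrable_norm_pow two_ne_zero
  have hGint : ∀ m, Integrable (fun x : Sph d => ‖sphGrad (p m) x‖ ^ 2) μ := fun m =>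
    integrable_of_continuous ((hGc m).norm.pow 2) _
  -- Green's formula has the same right side for `g` and for its projection, because it tests only
  -- against polynomials in the range of the projection. So `∫ ⟪H, ∇₀p⟫ = ∫ ‖∇₀p‖²`, and `2 ⟪a, b⟫ ≤
  -- ‖a‖² + ‖b‖²` gives the bound.
  have hbound : ∀ m, e (m + 1) ≤ ∫ x, ‖H x‖ ^ 2 ∂μ := fun m => by
    obtain ⟨r, hr, h⟩ := exists_green hRp hκ (hp (m + 1)) (hpinv (m + 1))
    have h1 := h _ _ hg hH hw
    have h2 := h _ _ (hpL (m + 1)) (hGL (m + 1)) (hpw (m + 1))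
    rw [hproj (m + 1) _ (hp _), hproj (m + 1) r (polyLT_le_succ _ hr), ← h2] at h1
    simp only [real_inner_self_eq_norm_sq] at h1
    have h3 : ∫ x, ⟪H x, sphGrad (p (m + 1)) x⟫_ℝ ∂μ ≤ (∫ x, ‖H x‖ ^ 2 ∂μ + e (m + 1)) / 2 := by
      rw [he, ← integral_add hHint (hGint _), ← integral_div]
      exact integral_mono (integrable_inner_of_memLp hH (hGL _)) ((hHint.add (hGint _)).div_const 2)
        fun x => two_mul_inner_le _ _
    have h4 : e (m + 1) = ∫ x : Sph d, ‖sphGrad (p (m + 1)) x‖ ^ 2 ∂μ := rfl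
    linarith
  -- The increment `u` has degree at most `m` and is orthogonal to all lower degrees. In Green's
  -- formula this kills the remainders and the cross term with `p m`, so norms and energies are
  -- additive and only the factor `m (m + 2λ)` survives.
  have hstep : ∀ m, 0 ≤ n (m + 1) - n m ∧
      e (m + 1) - e m = m * (m + 2 * lam Rp κ) * (n (m + 1) - n m) := fun m => by
    set u : E d → ℝ := p (m + 1) - p m with hu
    have hpm := polyLT_le_succ _ (hp m)
    have hum : u ∈ polyLT d (m + 1) := sub_mem (hp _) hpm
    have huL := memLp_of_continuous (continuous_of_mem_polyLT hum) μ
    have hus := contDiff_of_mem_polyLT hum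
    have huinv : ∀ v ∈ Rp, ∀ᵐ x : Sph d ∂μ, u (refl v x) = u x := fun v hv => by
      filter_upwards [hpinv m v hv, hpinv (m + 1) v hv] with x h1 h2
      simp only [hu, Pi.sub_apply, h1, h2]
    have huw := isWeakDunklGrad_sphGrad hd0 hRp hκ hus huinv
    have hugc := continuous_sphGrad (hus.of_le (by simp : (1 : WithTop ℕ∞) ≤ ∞))
    have hugL := memLp_of_continuous hugc μ
    have huorth : ∀ q ∈ polyLT d m, ∫ x : Sph d, u x * q x ∂μ = 0 := fun q hq => by
      have hqL := memLp_of_continuous (continuous_of_mem_polyLT hq) μ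
      simp only [hu, Pi.sub_apply, sub_mul]
      rw [integral_sub (integrable_mul_of_memLp (hpL _) hqL)
        (integrable_mul_of_memLp (hpL m) hqL), ← hproj m q hq,
        ← hproj (m + 1) q (polyLT_le_succ _ hq), sub_self]
    have hgrad : ∀ x, sphGrad (p (m + 1)) x = sphGrad u x + sphGrad (p m) x := fun x => by
      have h1 : fderiv ℝ (p (m + 1)) x = fderiv ℝ u x + fderiv ℝ (p m) x := by
        rw [hu, fderiv_sub ((hps _).differentiable (by simp) x)
          ((hps _).differentiable (by simp) x), sub_add_cancel]
      refine ext_inner_right ℝ fun w => ?_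
      rw [inner_add_left, inner_sphGrad, inner_sphGrad, inner_sphGrad, h1]
      rfl
    obtain ⟨r, hr, h1⟩ := exists_green hRp hκ hum huinv
    have hself := h1 _ _ huL hugL huw
    rw [huorth r hr, sub_zero] at hself
    obtain ⟨s, hs, h2⟩ := exists_green hRp hκ hpm (hpinv m)
    have hcross := h2 _ _ huL hugL huw
    rw [huorth s hs, huorth _ (hp m), mul_zero, sub_zero] at hcross
    have hsq : ∀ x : Sph d, p (m + 1) x ^ 2 = u x * u x + 2 * (u x * p m x) + p m x ^ 2 :=
      fun x => by
        simp only [hu, Pi.sub_apply]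
        ring
    have hn1 : n (m + 1) = ∫ x : Sph d, u x * u x ∂μ + n m := by
      have i1 := integrable_mul_of_memLp huL huL
      have i2 := (integrable_mul_of_memLp huL (hpL m)).const_mul 2
      have i12 : Integrable (fun x : Sph d => u x * u x + 2 * (u x * p m x)) μ := i1.add i2
      simp only [hn, hsq]
      rw [integral_add i12 (hpL m).integrable_sq, integral_add i1 i2, integral_const_mul,
        huorth _ (hp m)]
      ring
    have he1 : e (m + 1) = ∫ x : Sph d, ⟪sphGrad u x, sphGrad u x⟫_ℝ ∂μ + e m := by
      have i1 : Integrable (fun x : Sph d => ⟪sphGrad u x, sphGrad u x⟫_ℝ) μ :=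
        integrable_inner_of_memLp hugL hugL
      have i2 : Integrable (fun x : Sph d => 2 * ⟪sphGrad u x, sphGrad (p m) x⟫_ℝ) μ :=
        (integrable_inner_of_memLp hugL (hGL m)).const_mul 2
      have i12 : Integrable (fun x : Sph d => ⟪sphGrad u x, sphGrad u x⟫_ℝ +
        2 * ⟪sphGrad u x, sphGrad (p m) x⟫_ℝ) μ := i1.add i2
      simp only [he, hgrad, norm_add_sq_real]
      simp only [← real_inner_self_eq_norm_sq] at i12 ⊢
      rw [integral_add i12 (by simpa only [real_inner_self_eq_norm_sq] using hGint m),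
        integral_add i1 i2, integral_const_mul, hcross]
      ring
    rw [hn1, he1, hself]
    refine ⟨?_, by ring⟩
    rw [add_sub_cancel_right]
    exact integral_nonneg fun x => mul_self_nonneg _
  -- The projection to constants is zero since `g` has mean zero.
  have hn1 : n 1 = 0 := by
    obtain ⟨c, hc⟩ : ∃ c : ℝ, p 1 = fun _ => c := by
      refine polyLT_succ_induction (P := fun p => ∃ c : ℝ, p = fun _ => c) ⟨1, rfl⟩
        (fun q hq j => ⟨0, ?_⟩) ?_ ?_ (hp 1)
      · rw [polyLT, Submodule.mem_bot] at hq
        simp [hq]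
      · rintro _ - _ - ⟨a, rfl⟩ ⟨b, rfl⟩
        exact ⟨a + b, rfl⟩
      · rintro a _ - ⟨b, rfl⟩
        exact ⟨a * b, rfl⟩
    have h1 := hproj 1 _ (hp 1)
    simp only [hn, sq]
    rw [← h1]
    simp only [hc, integral_mul_const, hmean, zero_mul]
  have hpoin : ∀ m, 2 * lam Rp κ * n (m + 1) ≤ e (m + 1) := fun m => by
    induction m with
    | zero =>
      rw [zero_add, hn1, mul_zero]
      exact integral_nonneg fun x => by positivity
    | succ m ih =>
      obtain ⟨h1, h2⟩ := hstep (m + 1)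
      -- Only degrees from `1` on occur here; `2λ` suffices although the factor is at least `1 +
      -- 2λ`.
      have h3 : 2 * lam Rp κ ≤ ((m + 1 : ℕ) : ℝ) * (((m + 1 : ℕ) : ℝ) + 2 * lam Rp κ) := by
        have : (0 : ℝ) ≤ m := Nat.cast_nonneg m
        push_cast
        nlinarith [mul_nonneg this hlam]
      have h4 := mul_le_mul_of_nonneg_right h3 h1
      linarith
  have hdist : Tendsto (fun m => ∫ x, (g x - p (m + 1) x) ^ 2 ∂μ) atTop (𝓝 0) := by
    rw [Metric.tendsto_atTop]
    intro ε hε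
    obtain ⟨M, q, hq, hqε⟩ := exists_poly_near μ hg hε
    refine ⟨M, fun m hm => ?_⟩
    have hqL := memLp_of_continuous (continuous_of_mem_polyLT hq) μ
    have hqm : q ∈ polyLT d (m + 1) := polyLT_mono (by omega) hq
    have hz := horth (m + 1) _ (sub_mem (hp (m + 1)) hqm)
    have i1 : Integrable (fun x : Sph d => (g x - p (m + 1) x) ^ 2) μ :=
      (hg.sub (hpL _)).integrable_sq
    have i2 : Integrable (fun x : Sph d => 2 * ((g x - p (m + 1) x) *
        (p (m + 1) - q) x)) μ :=
      (integrable_mul_of_memLp (hg.sub (hpL (m + 1))) ((hpL (m + 1)).sub hqL)).const_mul 2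
    have i12 : Integrable (fun x : Sph d => (g x - p (m + 1) x) ^ 2 +
        2 * ((g x - p (m + 1) x) * (p (m + 1) - q) x)) μ := i1.add i2
    -- Best approximation: `(g - q)²` exceeds `(g - p)² + 2 (g - p)(p - q)` by `(p - q)²`, and the
    -- mixed term integrates to zero.
    have h1 : ∫ x : Sph d, (g x - p (m + 1) x) ^ 2 ∂μ ≤ ∫ x : Sph d, (g x - q x) ^ 2 ∂μ := by
      calc ∫ x : Sph d, (g x - p (m + 1) x) ^ 2 ∂μ
          = ∫ x : Sph d, ((g x - p (m + 1) x) ^ 2 +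
            2 * ((g x - p (m + 1) x) * (p (m + 1) - q) x)) ∂μ := by
            rw [integral_add i1 i2, integral_const_mul, hz, mul_zero, add_zero]
        _ ≤ _ := by
            refine integral_mono i12 (hg.sub hqL).integrable_sq fun x => ?_
            simp only [Pi.sub_apply]
            nlinarith [sq_nonneg (p (m + 1) x - q x)]
    rw [Real.dist_eq, sub_zero, abs_of_nonneg (integral_nonneg fun x => sq_nonneg _)]
    linarith
  have hlim : ∀ {c : Sph d → ℝ}, Continuous c → (∀ x, |c x| ≤ 1) →
      Tendsto (fun m => ∫ x : Sph d, c x * p (m + 1) x ^ 2 ∂μ) atTop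
        (𝓝 (∫ x, c x * g x ^ 2 ∂μ)) := fun hc hc1 =>
    tendsto_integral_mul_sq hg (fun m => hpL (m + 1)) hdist hc hc1
  have hcoord : ∀ (x : Sph d) j, |(x : E d) j| ≤ 1 := fun x j => by
    have := PiLp.norm_apply_le (x : E d) j
    simpa using this
  refine ⟨?_, fun j => ?_⟩
  · have h1 := hlim (c := fun _ => 1) continuous_const (by simp)
    simp only [one_mul] at h1
    exact le_of_tendsto (h1.const_mul _)
      (Eventually.of_forall fun m => (hpoin m).trans (hbound m))
  · have h1 := hlim (c := fun x : Sph d => (x : E d) j) (by fun_prop) (fun x => hcoord x j)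
    have h2 := hlim (c := fun x : Sph d => 1 - (x : E d) j ^ 2) (by fun_prop) (fun x => by
      have h3 : (x : E d) j ^ 2 ≤ 1 := (sq_le_one_iff_abs_le_one _).2 (hcoord x j)
      rw [abs_le]
      constructor <;> nlinarith [sq_nonneg ((x : E d) j)])
    refine le_of_tendsto_of_tendsto' ((h1.const_mul _).pow 2) (h2.const_mul _) fun m => ?_
    refine (uncertainty_smooth hd0 hRp hκ (hps _) (hpinv _) j).trans ?_
    refine mul_le_mul_of_nonneg_right (hbound m) (integral_nonneg fun x => ?_)
    have h3 : (x : E d) j ^ 2 ≤ 1 := (sq_le_one_iff_abs_le_one _).2 (hcoord x j)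
    exact mul_nonneg (by linarith) (sq_nonneg _)

end DunklSphere

/-! ### The distributional spherical gradient: existence and uniqueness -/

namespace DunklSphere

variable {d : ℕ} {Rp : Finset (E d)} {κ : E d → ℝ} {𝕜 : Type*} [RCLike 𝕜]

open Filter Topology

theorem isOpen_hWeight_ne_zero (hκ : IsMultiplicity Rp κ) :
    IsOpen {x : E d | hWeight Rp κ x ≠ 0} :=
  isOpen_ne_fun (continuous_hWeight hκ) continuous_const

/-- `Real.log` is even, so no absolute value is needed; for `κ v = 0` the logarithm may be taken at
`0`, but its coefficient vanishes. -/
theorem hWeight_sq_eq_exp {x : E d} (hx : hWeight Rp κ x ≠ 0) :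
    hWeight Rp κ x ^ 2 = Real.exp (∑ v ∈ Rp, 2 * κ v * Real.log ⟪x, v⟫_ℝ) := by
  rw [Real.exp_sum, hWeight, ← Finset.prod_pow]
  refine Finset.prod_congr rfl fun v hv => ?_
  by_cases hk : κ v = 0
  · simp [hk]
  · have h := inner_ne_zero_of_hWeight hx hv hk
    rw [Real.rpow_def_of_pos (abs_pos.2 h), ← Real.exp_nat_mul, Real.log_abs]
    congr 1
    push_cast
    ring

theorem hWeight_sq_eventuallyEq (hκ : IsMultiplicity Rp κ) {x : E d}
    (hx : hWeight Rp κ x ≠ 0) : (fun y => hWeight Rp κ y ^ 2) =ᶠ[𝓝 x]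
      fun y => Real.exp (∑ v ∈ Rp, 2 * κ v * Real.log ⟪y, v⟫_ℝ) := by
  filter_upwards [(isOpen_hWeight_ne_zero hκ).mem_nhds hx] with y hy
  exact hWeight_sq_eq_exp hy

theorem contDiffAt_hWeight_sq (hκ : IsMultiplicity Rp κ) {x : E d} (hx : hWeight Rp κ x ≠ 0) :
    ContDiffAt ℝ ∞ (fun y => hWeight Rp κ y ^ 2) x := by
  refine ContDiffAt.congr_of_eventuallyEq ?_ (hWeight_sq_eventuallyEq hκ hx)
  refine Real.contDiff_exp.contDiffAt.comp x (ContDiffAt.sum fun v hv => ?_)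
  by_cases hk : κ v = 0
  · simp only [hk, mul_zero, zero_mul]
    exact contDiffAt_const
  · exact contDiffAt_const.mul ((contDiffAt_id.inner ℝ contDiffAt_const).log
      (inner_ne_zero_of_hWeight hx hv hk))

theorem fderiv_hWeight_sq (hκ : IsMultiplicity Rp κ) {x : E d} (hx : hWeight Rp κ x ≠ 0)
    (w : E d) : fderiv ℝ (fun y => hWeight Rp κ y ^ 2) x w =
      hWeight Rp κ x ^ 2 * ∑ v ∈ Rp, 2 * κ v * (⟪w, v⟫_ℝ / ⟪x, v⟫_ℝ) := by
  have hd : HasDerivAt (fun t : ℝ => hWeight Rp κ (x + t • w) ^ 2)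
      (fderiv ℝ (fun y => hWeight Rp κ y ^ 2) x w) 0 :=
    ((contDiffAt_hWeight_sq hκ hx).differentiableAt (by simp)).hasFDerivAt.hasLineDerivAt w
  refine hd.unique ?_
  have h1 : ∀ v ∈ Rp, HasDerivAt (fun t : ℝ => 2 * κ v * Real.log ⟪x + t • w, v⟫_ℝ)
      (2 * κ v * (⟪w, v⟫_ℝ / ⟪x, v⟫_ℝ)) 0 := fun v hv => by
    by_cases hk : κ v = 0
    · simp only [hk, mul_zero, zero_mul]
      exact hasDerivAt_const _ _
    · have h2 : HasDerivAt (fun t : ℝ => ⟪x + t • w, v⟫_ℝ) ⟪w, v⟫_ℝ 0 := by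
        simp only [inner_add_left, real_inner_smul_left]
        simpa using ((hasDerivAt_id (0 : ℝ)).mul_const ⟪w, v⟫_ℝ).const_add ⟪x, v⟫_ℝ
      have h3 := (h2.log (by simpa using inner_ne_zero_of_hWeight hx hv hk)).const_mul (2 * κ v)
      simpa using h3
  have h4 := (HasDerivAt.fun_sum h1).exp
  simp only [zero_smul, add_zero, ← hWeight_sq_eq_exp hx] at h4
  refine h4.congr_of_eventuallyEq ?_
  have hc : Tendsto (fun t : ℝ => x + t • w) (𝓝 0) (𝓝 x) := by
    have : Continuous fun t : ℝ => x + t • w := by fun_prop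
    simpa using this.tendsto 0
  exact hc.eventually (hWeight_sq_eventuallyEq hκ hx)

theorem inner_sphGrad_hWeight_sq (hκ : IsMultiplicity Rp κ) {x : E d}
    (hx : hWeight Rp κ x ≠ 0) (w : E d) :
    ⟪sphGrad (fun y => hWeight Rp κ y ^ 2) x, w⟫_ℝ = hWeight Rp κ x ^ 2 *
      (∑ v ∈ Rp, 2 * κ v * (⟪w, v⟫_ℝ / ⟪x, v⟫_ℝ) - 2 * gam Rp κ * ⟪x, w⟫_ℝ) := by
  rw [inner_sphGrad, fderiv_hWeight_sq hκ hx, gam]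
  congr 1
  rw [Finset.mul_sum, Finset.sum_mul, ← Finset.sum_sub_distrib]
  refine Finset.sum_congr rfl fun v hv => ?_
  by_cases hk : κ v = 0
  · simp [hk]
  · have := inner_ne_zero_of_hWeight hx hv hk
    rw [inner_sub_left, real_inner_smul_left]
    field_simp

theorem contDiff_mul_of_tsupport_subset {U : Set (E d)} {ψ k : E d → ℝ} (hψ : ContDiff ℝ ∞ ψ)
    (hs : tsupport ψ ⊆ U) (hk : ∀ x ∈ U, ContDiffAt ℝ ∞ k x) :
    ContDiff ℝ ∞ fun x => ψ x * k x := by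
  rw [contDiff_iff_contDiffAt]
  intro x
  by_cases hx : x ∈ tsupport ψ
  · exact hψ.contDiffAt.mul (hk x (hs hx))
  · refine (contDiffAt_const (c := (0 : ℝ))).congr_of_eventuallyEq ?_
    filter_upwards [notMem_tsupport_iff_eventuallyEq.1 hx] with y hy
    rw [hy]
    simp

theorem integrable_smul_of_continuous {V : Type*} [NormedAddCommGroup V] [NormedSpace ℝ V]
    {μ : Measure (Sph d)} {c : Sph d → ℝ} (hc : Continuous c) {f : Sph d → V}
    (hf : Integrable f μ) : Integrable (fun x => c x • f x) μ := by
  obtain ⟨C, hC⟩ := isCompact_univ.exists_bound_of_continuousOn hc.continuousOn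
  exact hf.bdd_smul C hc.aestronglyMeasurable (Eventually.of_forall fun x => hC x trivial)

/-- On a compact set that avoids the zeros of `h_κ` the factor `h_κ⁻²` is bounded, so the weight can
be divided out. -/
theorem locallyIntegrableOn_of_memLp {V : Type*} [NormedAddCommGroup V] [NormedSpace ℝ V]
    (hκ : IsMultiplicity Rp κ) {F : Sph d → V} (hF : MemLp F 2 (wMeas Rp κ)) :
    LocallyIntegrableOn F {x : Sph d | hWeight Rp κ (x : E d) ≠ 0} (surf d) := by
  have hfm := isFiniteMeasure_wMeas (d := d) hκ
  have hopen : IsOpen {x : Sph d | hWeight Rp κ (x : E d) ≠ 0} :=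
    (isOpen_hWeight_ne_zero hκ).preimage continuous_subtype_val
  rw [locallyIntegrableOn_iff hopen.isLocallyClosed]
  intro K hK hKc
  have h1 : Integrable F (wMeas Rp κ) := hF.integrable (by norm_num)
  rw [wMeas, integrable_withDensity_iff_integrable_smul' (measurable_hWeight hκ)
    (Eventually.of_forall fun _ => ENNReal.ofReal_lt_top)] at h1
  have hc : ContinuousOn (fun x : Sph d => (hWeight Rp κ (x : E d) ^ 2)⁻¹) K := by
    refine ContinuousOn.inv₀ ?_ fun x hx => pow_ne_zero 2 (hK hx)
    exact (((continuous_hWeight hκ).comp continuous_subtype_val).pow 2).continuousOn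
  refine (h1.integrableOn.continuousOn_smul hc hKc).congr_fun (fun x hx => ?_)
    hKc.measurableSet
  simp only
  rw [ENNReal.toReal_ofReal (sq_nonneg _), smul_smul, inv_mul_cancel₀ (pow_ne_zero 2 (hK hx)),
    one_smul]

theorem integral_comp_act (hRp : IsPositiveSystem Rp) (hκ : IsMultiplicity Rp κ) {v : E d}
    (hv : v ∈ Rp) {V : Type*} [NormedAddCommGroup V] [NormedSpace ℝ V] (f : Sph d → V) :
    ∫ x, f (act (refl v) x) ∂(wMeas Rp κ) = ∫ x, f x ∂(wMeas Rp κ) := by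
  have hmp := measurePreserving_act hRp hκ hv
  have hinvol : Function.Involutive (act (refl v)) := fun x =>
    Subtype.ext (refl_refl v (x : E d))
  exact hmp.integral_comp
    (MeasurableEquiv.ofInvolutive _ hinvol hmp.measurable).measurableEmbedding f

theorem integral_comp_refl_smul (hRp : IsPositiveSystem Rp) (hκ : IsMultiplicity Rp κ) {v : E d}
    (hv : v ∈ Rp) {f : Sph d → 𝕜} (hinv : ∀ᵐ x ∂(wMeas Rp κ), f (act (refl v) x) = f x)
    (k : E d → ℝ) : ∫ x : Sph d, k (refl v x) • f x ∂(wMeas Rp κ) =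
      ∫ x : Sph d, k x • f x ∂(wMeas Rp κ) := by
  rw [← integral_comp_act hRp hκ hv fun x : Sph d => k x • f x]
  refine integral_congr_ae ?_
  filter_upwards [hinv] with x hx
  simp only [hx]
  simp only [act]

/-- For invariant functions, the weak Dunkl gradient is the weak spherical gradient off the
zeros of the weight. -/
theorem isWeakSphGrad_of_isWeakDunklGrad (hRp : IsPositiveSystem Rp)
    (hκ : IsMultiplicity Rp κ) {f : Sph d → 𝕜} {F : Sph d → EuclideanSpace 𝕜 (Fin d)}
    (hf : MemLp f 2 (wMeas Rp κ)) (hF : MemLp F 2 (wMeas Rp κ)) (hw : IsWeakDunklGrad Rp κ f F)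
    (hinv : ∀ v ∈ Rp, ∀ᵐ x ∂(wMeas Rp κ), f (act (refl v) x) = f x) :
    IsWeakSphGrad Rp κ f F := by
  refine ⟨locallyIntegrableOn_of_memLp hκ hF, fun ψ hψ hs j => ?_⟩
  have hfm := isFiniteMeasure_wMeas (d := d) hκ
  have hfi : Integrable f (wMeas Rp κ) := hf.integrable (by norm_num)
  set U := {x : E d | hWeight Rp κ x ≠ 0} with hU
  set w : E d := EuclideanSpace.single j 1 with hwdef
  -- Dividing by the weight turns `φ h_κ² dσ` into `ψ dσ`; `φ` is smooth since `ψ` is supported off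
  -- the zeros of `h_κ`.
  set φ : E d → ℝ := fun x => ψ x * (hWeight Rp κ x ^ 2)⁻¹ with hφdef
  have hφ : ContDiff ℝ ∞ φ := contDiff_mul_of_tsupport_subset hψ hs fun x hx =>
    (contDiffAt_hWeight_sq hκ hx).inv (pow_ne_zero 2 hx)
  have hφs : tsupport φ ⊆ U := (tsupport_mul_subset_left).trans hs
  have hψ0 : ∀ x, x ∉ U → ψ x = 0 := fun x hx =>
    image_eq_zero_of_notMem_tsupport fun h => hx (hs h)
  have hprod : ∀ x, φ x * hWeight Rp κ x ^ 2 = ψ x := fun x => by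
    by_cases hx : x ∈ U
    · rw [hφdef]
      simp only
      rw [mul_assoc, inv_mul_cancel₀ (pow_ne_zero 2 hx), mul_one]
    · simp [hφdef, hψ0 x hx]
  -- The factor `κ v` belongs to `k`: if it is nonzero, `φ` vanishes near the hyperplane of `v`, and
  -- otherwise `k v = 0`. Either way `k v` is continuous.
  set k : E d → E d → ℝ := fun v x => κ v * (φ x / ⟪x, v⟫_ℝ) with hk
  have hkc : ∀ v ∈ Rp, Continuous (k v) := fun v hv => by
    by_cases hkv : κ v = 0
    · simp only [hk, hkv, zero_mul]
      exact continuous_const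
    · have h1 := contDiff_mul_of_tsupport_subset (k := fun x => (⟪x, v⟫_ℝ)⁻¹) hφ hφs fun x hx =>
        (contDiffAt_id.inner ℝ contDiffAt_const).inv (inner_ne_zero_of_hWeight hx hv hkv)
      exact continuous_const.mul (h1.continuous.congr fun x => (div_eq_mul_inv _ _).symm)
  set A : E d → ℝ := fun x => ⟪sphGrad φ x, w⟫_ℝ + ∑ v ∈ Rp, 2 * ⟪w, v⟫_ℝ * k v x -
    (2 * lam Rp κ + 1) * x j * φ x with hA
  have hAc : Continuous A := by
    have h1 := continuous_inner_sphGrad (hφ.of_le (by simp : (1 : WithTop ℕ∞) ≤ ∞)) w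
    have h2 := hφ.continuous
    exact (h1.add (continuous_finsetSum _ fun v hv => continuous_const.mul (hkc v hv))).sub
      (by fun_prop)
  -- Product rule for `ψ = φ h_κ²`: the tangential logarithmic derivative of the weight yields the
  -- terms `2 k v`, and its radial correction `-2γ x_j` raises `d - 1` to `2λ + 1`.
  have hpt : ∀ x, sphGrad ψ x j - ((d : ℝ) - 1) * x j * ψ x = hWeight Rp κ x ^ 2 * A x :=
    fun x => by
      by_cases hx : x ∈ U
      · have h1 : sphGrad ψ x j = φ x * ⟪sphGrad (fun y => hWeight Rp κ y ^ 2) x, w⟫_ℝ +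
            hWeight Rp κ x ^ 2 * ⟪sphGrad φ x, w⟫_ℝ := by
          rw [← sphGrad_mul (hφ.differentiable (by simp) x)
            ((contDiffAt_hWeight_sq hκ hx).differentiableAt (by simp)), funext hprod, hwdef,
            inner_single_one]
        have h2 : φ x * ∑ v ∈ Rp, 2 * κ v * (⟪w, v⟫_ℝ / ⟪x, v⟫_ℝ) =
            ∑ v ∈ Rp, 2 * ⟪w, v⟫_ℝ * k v x := by
          rw [Finset.mul_sum]
          refine Finset.sum_congr rfl fun v _ => ?_
          simp only [hk]
          ring
        have h3 : ⟪x, w⟫_ℝ = x j := inner_single_one x j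
        simp only [hA]
        rw [h1, inner_sphGrad_hWeight_sq hκ hx, ← hprod, h3, ← h2, lam]
        ring
      · have h1 : fderiv ℝ ψ x = 0 := image_eq_zero_of_notMem_tsupport fun h =>
          hx (hs (tsupport_fderiv_subset ℝ h))
        have h2 : hWeight Rp κ x = 0 := not_not.1 hx
        rw [sphGrad_apply, h1, hψ0 x hx, h2]
        simp
  have hL : ∫ x : Sph d, ψ x • F x j ∂(surf d) = ∫ x : Sph d, φ x • F x j ∂(wMeas Rp κ) := by
    rw [integral_wMeas hκ]
    refine integral_congr_ae (Eventually.of_forall fun x => ?_)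
    simp only
    rw [smul_smul, mul_comm, hprod]
  have hR : ∫ x : Sph d, (sphGrad ψ (x : E d) j - ((d : ℝ) - 1) * (x : E d) j * ψ (x : E d)) •
      f x ∂(surf d) = ∫ x : Sph d, A x • f x ∂(wMeas Rp κ) := by
    rw [integral_wMeas hκ]
    refine integral_congr_ae (Eventually.of_forall fun x => ?_)
    simp only
    rw [smul_smul, hpt]
  have hAi : Integrable (fun x : Sph d => A x • f x) (wMeas Rp κ) :=
    integrable_smul_of_continuous (hAc.comp continuous_subtype_val) hfi
  have hki : ∀ v ∈ Rp, Integrable (fun x : Sph d => k v x • f x) (wMeas Rp κ) := fun v hv =>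
    integrable_smul_of_continuous ((hkc v hv).comp continuous_subtype_val) hfi
  have hkri : ∀ v ∈ Rp, Integrable (fun x : Sph d => k v (refl v x) • f x) (wMeas Rp κ) :=
    fun v hv => integrable_smul_of_continuous
      (((hkc v hv).comp (refl v).continuous).comp continuous_subtype_val) hfi
  have hsym : ∀ v ∈ Rp, ∫ x : Sph d, ⟪w, v⟫_ℝ • (k v (refl v x) • f x - k v x • f x)
      ∂(wMeas Rp κ) = 0 := fun v hv => by
    rw [integral_smul, integral_sub (hkri v hv) (hki v hv)]
    rw [integral_comp_refl_smul hRp hκ hv (hinv v hv), sub_self, smul_zero]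
  have hsi : ∀ v ∈ Rp, Integrable (fun x : Sph d => ⟪w, v⟫_ℝ •
      (k v (refl v x) • f x - k v x • f x)) (wMeas Rp κ) := fun v hv =>
    ((hkri v hv).sub (hki v hv)).smul ⟪w, v⟫_ℝ
  -- The difference term of `v` equals `k v x + k v (refl v x)`, because `⟪x, v⟫` changes sign.
  -- Against invariant `f` both parts have the same integral, so it acts as the `2 k v` in `A`.
  have hD : ∀ x : Sph d, (dunklSphGrad Rp κ φ (x : E d) j
      - (2 * lam Rp κ + 1) * (x : E d) j * φ (x : E d)) • f x =
      A x • f x + ∑ v ∈ Rp, ⟪w, v⟫_ℝ • (k v (refl v x) • f x - k v x • f x) := fun x => by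
    have h1 : dunklSphGrad Rp κ φ (x : E d) j = ⟪sphGrad φ x, w⟫_ℝ +
        ∑ v ∈ Rp, ⟪w, v⟫_ℝ * (k v (refl v x) + k v x) := by
      rw [← inner_single_one, inner_dunklSphGrad]
      congr 1
      refine Finset.sum_congr rfl fun v _ => ?_
      simp only [diffOp, hk, inner_refl_self]
      rw [div_neg]
      ring
    simp only [smul_smul, ← sub_smul]
    rw [← Finset.sum_smul, ← add_smul, h1, hA]
    congr 1
    have h2 : ∑ v ∈ Rp, ⟪w, v⟫_ℝ * (k v (refl v x) + k v x) =
        ∑ v ∈ Rp, 2 * ⟪w, v⟫_ℝ * k v x +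
          ∑ v ∈ Rp, ⟪w, v⟫_ℝ * (k v (refl v x) - k v x) := by
      rw [← Finset.sum_add_distrib]
      exact Finset.sum_congr rfl fun v _ => by ring
    rw [h2]
    ring
  rw [hL, hw φ hφ j, hR]
  simp only [hD]
  rw [integral_add hAi (integrable_finsetSum _ hsi), integral_finsetSum _ hsi,
    Finset.sum_eq_zero hsym, add_zero]

/-- The weak spherical gradient is unique almost everywhere. -/
theorem IsWeakSphGrad.ae_eq (hκ : IsMultiplicity Rp κ) {f : Sph d → 𝕜}
    {Ψ₁ Ψ₂ : Sph d → EuclideanSpace 𝕜 (Fin d)} (h₁ : IsWeakSphGrad Rp κ f Ψ₁)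
    (h₂ : IsWeakSphGrad Rp κ f Ψ₂) : Ψ₁ =ᵐ[wMeas Rp κ] Ψ₂ := by
  set U := {x : E d | hWeight Rp κ x ≠ 0} with hU
  have hUo : IsOpen U := isOpen_hWeight_ne_zero hκ
  have hUo' : IsOpen {x : Sph d | hWeight Rp κ (x : E d) ≠ 0} :=
    hUo.preimage continuous_subtype_val
  have hemb : Topology.IsClosedEmbedding (Subtype.val : Sph d → E d) :=
    Metric.isClosed_sphere.isClosedEmbedding_subtypeVal
  have hcoord : ∀ {Ψ : Sph d → EuclideanSpace 𝕜 (Fin d)}, IsWeakSphGrad Rp κ f Ψ → ∀ j,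
      ∀ K ⊆ {x : Sph d | hWeight Rp κ (x : E d) ≠ 0}, IsCompact K →
      IntegrableOn (fun x => Ψ x j) K (surf d) := fun hΨ j K hK hKc => by
    have h3 := (locallyIntegrableOn_iff hUo'.isLocallyClosed).1 hΨ.1 K hK hKc
    exact Integrable.mono h3 ((EuclideanSpace.proj (𝕜 := 𝕜) j).continuous.comp_aestronglyMeasurable
      h3.aestronglyMeasurable) (Eventually.of_forall fun x => PiLp.norm_apply_le _ _)
  have hj : ∀ j, ∀ᵐ x : Sph d ∂(surf d), (x : E d) ∈ U → Ψ₁ x j - Ψ₂ x j = 0 := fun j => by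
    -- Extended to `ℝ^d`, with the surface measure pushed forward, the difference falls under the
    -- fundamental lemma of the calculus of variations on an open set; values off the sphere do not
    -- matter.
    set u : E d → 𝕜 := Function.extend Subtype.val (fun x : Sph d => Ψ₁ x j - Ψ₂ x j) 0 with hu
    have hux : ∀ x : Sph d, u x = Ψ₁ x j - Ψ₂ x j := fun x =>
      Subtype.val_injective.extend_apply _ _ _
    have hli : LocallyIntegrableOn u U ((surf d).map Subtype.val) := by
      rw [locallyIntegrableOn_iff hUo.isLocallyClosed]
      intro K hK hKc
      rw [hemb.measurableEmbedding.integrableOn_map_iff]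
      have hKc' : IsCompact (Subtype.val ⁻¹' K : Set (Sph d)) := hemb.isCompact_preimage hKc
      exact ((hcoord h₁ j _ (fun x hx => hK hx) hKc').sub
        (hcoord h₂ j _ (fun x hx => hK hx) hKc')).congr_fun
          (fun x _ => (hux x).symm) hKc'.measurableSet
    have hz := hUo.ae_eq_zero_of_integral_contDiff_smul_eq_zero hli
      fun φ hφ hφc hφs => by
        rw [hemb.measurableEmbedding.integral_map]
        have hKc' : IsCompact (Subtype.val ⁻¹' tsupport φ : Set (Sph d)) :=
          hemb.isCompact_preimage hφc
        have hint : ∀ {Ψ : Sph d → EuclideanSpace 𝕜 (Fin d)}, IsWeakSphGrad Rp κ f Ψ →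
            Integrable (fun x : Sph d => φ x • Ψ x j) (surf d) := fun {Ψ} hΨ => by
          have h3 := (hcoord hΨ j _ (fun x hx => hφs hx) hKc').continuousOn_smul
            (hφ.continuous.comp continuous_subtype_val).continuousOn hKc'
          refine (integrableOn_iff_integrable_of_support_subset fun x hx => ?_).1 h3
          by_contra hx'
          have h4 : φ x = 0 := image_eq_zero_of_notMem_tsupport hx'
          exact hx (by simp [h4])
        simp only [hux, smul_sub]
        rw [integral_sub (hint h₁) (hint h₂), h₁.2 φ hφ hφs j, h₂.2 φ hφ hφs j, sub_self]
    have h5 := hemb.measurableEmbedding.ae_map_iff.1 hz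
    filter_upwards [h5] with x hx hxU
    rw [← hux]
    exact hx hxU
  have hall : ∀ᵐ x : Sph d ∂(wMeas Rp κ), ∀ j, (x : E d) ∈ U → Ψ₁ x j - Ψ₂ x j = 0 :=
    wMeas_absolutelyContinuous.ae_le (ae_all_iff.2 hj)
  filter_upwards [hall, ae_hWeight_ne_zero hκ] with x hx hx'
  ext j
  exact sub_eq_zero.1 (hx j hx')

end DunklSphere

/-! ### Real and imaginary parts, and the scalar optimization -/

namespace DunklSphere

variable {d : ℕ} {Rp : Finset (E d)} {κ : E d → ℝ} {𝕜 : Type*} [RCLike 𝕜]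

open Filter Topology

/-- A real linear functional applied to each coordinate of a vector. -/
noncomputable def mapCoord (L : 𝕜 →L[ℝ] ℝ) (y : EuclideanSpace 𝕜 (Fin d)) : E d :=
  WithLp.toLp 2 fun j => L (y j)

theorem memLp_mapCoord {L : 𝕜 →L[ℝ] ℝ} (hL : ∀ z, ‖L z‖ ≤ ‖z‖) {μ : Measure (Sph d)}
    {F : Sph d → EuclideanSpace 𝕜 (Fin d)} (hF : MemLp F 2 μ) :
    MemLp (fun x => mapCoord L (F x)) 2 μ := by
  have hc : Continuous fun y : EuclideanSpace 𝕜 (Fin d) => mapCoord L y := by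
    refine (PiLp.continuous_toLp 2 _).comp (continuous_pi fun j => L.continuous.comp ?_)
    fun_prop
  refine hF.mono (hc.comp_aestronglyMeasurable hF.aestronglyMeasurable)
    (Eventually.of_forall fun x => ?_)
  rw [EuclideanSpace.norm_eq, EuclideanSpace.norm_eq]
  refine Real.sqrt_le_sqrt (Finset.sum_le_sum fun j _ => ?_)
  exact pow_le_pow_left₀ (norm_nonneg _) (hL _) 2

theorem isWeakDunklGrad_mapCoord (hRp : IsPositiveSystem Rp) (hκ : IsMultiplicity Rp κ)
    (L : 𝕜 →L[ℝ] ℝ) {f : Sph d → 𝕜} {F : Sph d → EuclideanSpace 𝕜 (Fin d)}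
    (hf : MemLp f 2 (wMeas Rp κ)) (hF : MemLp F 2 (wMeas Rp κ)) (hw : IsWeakDunklGrad Rp κ f F) :
    IsWeakDunklGrad (𝕜 := ℝ) Rp κ (fun x => L (f x)) (fun x => mapCoord L (F x)) := by
  intro φ hφ j
  have hfm := isFiniteMeasure_wMeas (d := d) hκ
  have h1 : Integrable (fun x : Sph d => φ x • F x j) (wMeas Rp κ) := by
    refine integrable_smul_of_continuous (hφ.continuous.comp continuous_subtype_val) ?_
    have h2 : MemLp (fun x => F x j) 2 (wMeas Rp κ) :=
      hF.mono ((EuclideanSpace.proj (𝕜 := 𝕜) j).continuous.comp_aestronglyMeasurable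
        hF.aestronglyMeasurable) (Eventually.of_forall fun x => PiLp.norm_apply_le _ _)
    exact h2.integrable (by norm_num)
  have h2 := integrable_dunkl_integrand (κ := κ) hRp (hφ.of_le (by simp))
    (hf.integrable (by norm_num)) j
  have h3 := congrArg L (hw φ hφ j)
  rw [map_neg, ← L.integral_comp_comm h1, ← L.integral_comp_comm h2] at h3
  simp only [map_smul] at h3
  exact h3

/-- The cross term obeys `(X₁ X₂)² ≤ (N₁ B₂)(N₂ B₁)`, so the arithmetic–geometric mean inequality
applies. It recombines the uncertainty inequalities of the real and imaginary parts. -/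
theorem add_sq_le_mul_of_sq_le {X₁ X₂ N₁ N₂ B₁ B₂ : ℝ} (hN₁ : 0 ≤ N₁) (hN₂ : 0 ≤ N₂)
    (hB₁ : 0 ≤ B₁) (hB₂ : 0 ≤ B₂) (h₁ : X₁ ^ 2 ≤ N₁ * B₁) (h₂ : X₂ ^ 2 ≤ N₂ * B₂) :
    (X₁ + X₂) ^ 2 ≤ (N₁ + N₂) * (B₁ + B₂) := by
  have h3 : (2 * (X₁ * X₂)) ^ 2 ≤ (N₁ * B₂ + N₂ * B₁) ^ 2 := by
    have h4 := mul_le_mul h₁ h₂ (sq_nonneg _) (mul_nonneg hN₁ hB₁)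
    nlinarith [sq_nonneg (N₁ * B₂ - N₂ * B₁)]
  have h5 := abs_le_of_sq_le_sq h3 (by positivity)
  linarith [le_abs_self (2 * (X₁ * X₂))]

/-- The Poincaré inequality `2λ ≤ N` and the uncertainty inequality combine to the bound. -/
theorem uncertainty_scalar {L N α : ℝ} (hL : 0 ≤ L) (hN : 2 * L ≤ N)
    (h : (L + 1 / 2) ^ 2 * α ^ 2 ≤ N * (1 - α ^ 2)) :
    2 * L * (1 - √(2 * L) / √((L + 1 / 2) ^ 2 + 2 * L)) ≤ (1 - α) * N := by
  set D := (L + 1 / 2) ^ 2 + 2 * L with hD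
  have hDpos : 0 < D := by positivity
  -- `s` is the value of `α` at which the two lower bounds for `N` coincide.
  set s := √(2 * L) / √D with hs
  have hs0 : 0 ≤ s := by positivity
  have hsq : s ^ 2 * D = 2 * L := by
    rw [hs, div_pow, Real.sq_sqrt (by positivity), Real.sq_sqrt hDpos.le]
    field_simp
  have hs1 : s ≤ 1 := by
    refine (sq_le_one_iff₀ hs0).1 ?_
    by_contra! h'
    nlinarith [sq_nonneg (L + 1 / 2)]
  have hN0 : 0 ≤ N := by linarith
  -- Below `s` the Poincaré bound suffices: `(1 - α) N ≥ (1 - s) 2L`.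
  by_cases hαs : α ≤ s
  · nlinarith [mul_nonneg (sub_nonneg.2 hs1) (sub_nonneg.2 hN),
      mul_nonneg (sub_nonneg.2 hαs) hN0]
  · rw [not_le] at hαs
    have hα0 : 0 ≤ α := hs0.trans hαs.le
    -- Beyond `s` the uncertainty bound gives `(1 - α) N ≥ (L + 1/2)² α² / (1 + α)`, and `t² / (1 +
    -- t)` increases on `t ≥ 0`. At `t = s` the bound equals `2L (1 - s)`, which is `h2` with
    -- denominators cleared.
    have h1 : s ^ 2 * (1 + α) ≤ α ^ 2 * (1 + s) := by
      nlinarith [mul_nonneg hs0 hα0, mul_nonneg (mul_nonneg hs0 hα0) (sub_nonneg.2 hαs.le)]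
    have h2 : 2 * L * (1 - s) * (1 + s) = s ^ 2 * (L + 1 / 2) ^ 2 := by
      rw [hD] at hsq
      linear_combination -hsq
    have h3 : 2 * L * (1 - s) * (1 + α) * (1 + s) ≤ (1 - α) * N * (1 + α) * (1 + s) := by
      calc 2 * L * (1 - s) * (1 + α) * (1 + s) = (L + 1 / 2) ^ 2 * (s ^ 2 * (1 + α)) := by
            linear_combination (1 + α) * h2
        _ ≤ (L + 1 / 2) ^ 2 * (α ^ 2 * (1 + s)) := mul_le_mul_of_nonneg_left h1 (sq_nonneg _)
        _ = (L + 1 / 2) ^ 2 * α ^ 2 * (1 + s) := by ring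
        _ ≤ N * (1 - α ^ 2) * (1 + s) := mul_le_mul_of_nonneg_right h (by linarith)
        _ = _ := by ring
    exact le_of_mul_le_mul_right (le_of_mul_le_mul_right h3 (by linarith)) (by linarith)

theorem omega_nonneg : 0 ≤ omega Rp κ := integral_nonneg fun _ => sq_nonneg _

theorem wNorm_sq {V : Type*} [NormedAddCommGroup V] (f : Sph d → V) :
    wNorm Rp κ f ^ 2 = (omega Rp κ)⁻¹ * ∫ x, ‖f x‖ ^ 2 ∂(wMeas Rp κ) :=
  Real.sq_sqrt (mul_nonneg (inv_nonneg.2 omega_nonneg) (integral_nonneg fun _ => sq_nonneg _))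

/-- The Poincaré and uncertainty inequalities for scalar invariant Sobolev functions. -/
theorem poincare_and_uncertainty_rclike (hd : 2 ≤ d) (hRp : IsPositiveSystem Rp)
    (hκ : IsMultiplicity Rp κ) {f : Sph d → 𝕜} {F : Sph d → EuclideanSpace 𝕜 (Fin d)}
    (hf : MemLp f 2 (wMeas Rp κ)) (hF : MemLp F 2 (wMeas Rp κ)) (hw : IsWeakDunklGrad Rp κ f F)
    (hinv : ∀ v ∈ Rp, ∀ᵐ x ∂(wMeas Rp κ), f (act (refl v) x) = f x)
    (hmean : ∫ x, f x ∂(wMeas Rp κ) = 0) :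
    2 * lam Rp κ * ∫ x, ‖f x‖ ^ 2 ∂(wMeas Rp κ) ≤ ∫ x, ‖F x‖ ^ 2 ∂(wMeas Rp κ) ∧
    ∀ j, ((lam Rp κ + 1 / 2) * ∫ x : Sph d, (x : E d) j * ‖f x‖ ^ 2 ∂(wMeas Rp κ)) ^ 2 ≤
      (∫ x, ‖F x‖ ^ 2 ∂(wMeas Rp κ)) *
        ∫ x : Sph d, (1 - (x : E d) j ^ 2) * ‖f x‖ ^ 2 ∂(wMeas Rp κ) := by
  have hfm := isFiniteMeasure_wMeas (d := d) hκ
  have hfi : Integrable f (wMeas Rp κ) := hf.integrable (by norm_num)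
  have hre : ∀ z : 𝕜, ‖(RCLike.reCLM : 𝕜 →L[ℝ] ℝ) z‖ ≤ ‖z‖ := fun z => RCLike.norm_re_le_norm z
  have him : ∀ z : 𝕜, ‖(RCLike.imCLM : 𝕜 →L[ℝ] ℝ) z‖ ≤ ‖z‖ := fun z => RCLike.norm_im_le_norm z
  have hz : ∀ z : 𝕜, ‖z‖ ^ 2 = (RCLike.reCLM : 𝕜 →L[ℝ] ℝ) z ^ 2 +
      (RCLike.imCLM : 𝕜 →L[ℝ] ℝ) z ^ 2 := fun z => by
    rw [RCLike.norm_sq_eq_def, RCLike.reCLM_apply, RCLike.imCLM_apply, sq, sq]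
  have hZ : ∀ y : EuclideanSpace 𝕜 (Fin d), ‖y‖ ^ 2 =
      ‖mapCoord RCLike.reCLM y‖ ^ 2 + ‖mapCoord RCLike.imCLM y‖ ^ 2 := fun y => by
    rw [EuclideanSpace.norm_sq_eq, EuclideanSpace.norm_sq_eq, EuclideanSpace.norm_sq_eq,
      ← Finset.sum_add_distrib]
    refine Finset.sum_congr rfl fun j _ => ?_
    rw [hz]
    simp [mapCoord]
  have hLp : ∀ {L : 𝕜 →L[ℝ] ℝ}, (∀ z, ‖L z‖ ≤ ‖z‖) → MemLp (fun x => L (f x)) 2 (wMeas Rp κ) :=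
    fun {L} hL => hf.mono (L.continuous.comp_aestronglyMeasurable hf.aestronglyMeasurable)
      (Eventually.of_forall fun x => hL _)
  have hcore : ∀ {L : 𝕜 →L[ℝ] ℝ}, (∀ z, ‖L z‖ ≤ ‖z‖) → _ := fun {L} hL =>
    poincare_and_uncertainty hd hRp hκ (hLp hL) (memLp_mapCoord hL hF)
      (isWeakDunklGrad_mapCoord hRp hκ L hf hF hw)
      (fun v hv => by filter_upwards [hinv v hv] with x hx using by rw [hx])
      (by rw [L.integral_comp_comm hfi, hmean, map_zero])
  obtain ⟨p1, u1⟩ := hcore hre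
  obtain ⟨p2, u2⟩ := hcore him
  have hG1 := (memLp_mapCoord hre hF).integrable_norm_pow two_ne_zero
  have hG2 := (memLp_mapCoord him hF).integrable_norm_pow two_ne_zero
  have hN : ∫ x, ‖F x‖ ^ 2 ∂(wMeas Rp κ) =
      ∫ x, ‖mapCoord (RCLike.reCLM : 𝕜 →L[ℝ] ℝ) (F x)‖ ^ 2 ∂(wMeas Rp κ) +
      ∫ x, ‖mapCoord (RCLike.imCLM : 𝕜 →L[ℝ] ℝ) (F x)‖ ^ 2 ∂(wMeas Rp κ) := by
    simp_rw [hZ]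
    exact integral_add hG1 hG2
  have hsplit : ∀ {c : Sph d → ℝ}, Continuous c → ∫ x, c x * ‖f x‖ ^ 2 ∂(wMeas Rp κ) =
      ∫ x, c x * (RCLike.reCLM : 𝕜 →L[ℝ] ℝ) (f x) ^ 2 ∂(wMeas Rp κ) +
      ∫ x, c x * (RCLike.imCLM : 𝕜 →L[ℝ] ℝ) (f x) ^ 2 ∂(wMeas Rp κ) := fun {c} hc => by
    simp_rw [hz, mul_add]
    exact integral_add (integrable_smul_of_continuous hc (hLp hre).integrable_sq)
      (integrable_smul_of_continuous hc (hLp him).integrable_sq)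
  refine ⟨?_, fun j => ?_⟩
  · have h1 := hsplit (c := fun _ => 1) continuous_const
    simp only [one_mul] at h1
    rw [h1, hN, mul_add]
    exact add_le_add p1 p2
  · rw [hsplit (c := fun x : Sph d => (x : E d) j) (by fun_prop),
      hsplit (c := fun x : Sph d => 1 - (x : E d) j ^ 2) (by fun_prop), hN, mul_add]
    have hnn : ∀ x : Sph d, 0 ≤ 1 - (x : E d) j ^ 2 := fun x => by
      have h1 := PiLp.norm_apply_le (x : E d) j
      have h2 : |(x : E d) j| ≤ 1 := by simpa using h1
      linarith [(sq_le_one_iff_abs_le_one _).2 h2]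
    exact add_sq_le_mul_of_sq_le (integral_nonneg fun x => sq_nonneg _)
      (integral_nonneg fun x => sq_nonneg _)
      (integral_nonneg fun x => mul_nonneg (hnn x) (sq_nonneg _))
      (integral_nonneg fun x => mul_nonneg (hnn x) (sq_nonneg _)) (u1 j) (u2 j)

end DunklSphere

/-! ### Assembly of the theorem -/

theorem theorem4p1 {𝕜 : Type*} [RCLike 𝕜] {d : ℕ} (hd : 2 ≤ d)
    (Rp : Finset (E d)) (hRp : IsPositiveSystem Rp)
    (κ : E d → ℝ) (hκ : IsMultiplicity Rp κ)
    (f : Sph d → 𝕜) (hf : MemSobolev Rp κ f) (hinv : IsGInvariant Rp f)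
    (hmean : ∫ x, f x ∂(wMeas Rp κ) = 0) (hnorm : wNorm Rp κ f = 1) :
    (∃ Ψ : Sph d → EuclideanSpace 𝕜 (Fin d), IsWeakSphGrad Rp κ f Ψ) ∧
    ∀ Ψ : Sph d → EuclideanSpace 𝕜 (Fin d), IsWeakSphGrad Rp κ f Ψ →
      MemLp Ψ 2 (wMeas Rp κ) ∧
      uncertaintyConst Rp κ ≤
        (⨅ i : Fin d, (omega Rp κ)⁻¹ *
            ∫ x : Sph d, (1 - (x : E d) i) * ‖f x‖ ^ 2 ∂(wMeas Rp κ)) *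
          wNorm Rp κ Ψ ^ 2 := by
  obtain ⟨hfL, F, hF, hw⟩ := hf
  have hfm := isFiniteMeasure_wMeas (d := d) hκ
  have hinv' : ∀ v ∈ Rp, ∀ᵐ x ∂(wMeas Rp κ), f (act (refl v) x) = f x := fun v hv =>
    wMeas_absolutelyContinuous.ae_le (hinv _ (refl_mem_reflGroup hv))
  have hgrad := isWeakSphGrad_of_isWeakDunklGrad hRp hκ hfL hF hw hinv'
  refine ⟨⟨F, hgrad⟩, fun Ψ hΨ => ?_⟩
  have hae := hΨ.ae_eq hκ hgrad
  refine ⟨(memLp_congr_ae hae).2 hF, ?_⟩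
  have hNΨ : wNorm Rp κ Ψ ^ 2 = (omega Rp κ)⁻¹ * ∫ x, ‖F x‖ ^ 2 ∂(wMeas Rp κ) := by
    rw [wNorm_sq]
    congr 1
    refine integral_congr_ae ?_
    filter_upwards [hae] with x hx
    rw [hx]
  obtain ⟨hpoin, hunc⟩ := poincare_and_uncertainty_rclike hd hRp hκ hfL hF hw hinv' hmean
  have hf1 : (omega Rp κ)⁻¹ * ∫ x, ‖f x‖ ^ 2 ∂(wMeas Rp κ) = 1 := by
    rw [← wNorm_sq, hnorm, one_pow]
  -- With `ω = 0` the convention `0⁻¹ = 0` would force `‖f‖ = 0`, against the normalization.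
  have hc : 0 < omega Rp κ := by
    refine lt_of_le_of_ne omega_nonneg fun h => ?_
    rw [← h, inv_zero, zero_mul] at hf1
    exact zero_ne_one hf1
  have hfc : ∫ x, ‖f x‖ ^ 2 ∂(wMeas Rp κ) = omega Rp κ := by
    field_simp at hf1
    exact hf1
  have : Nonempty (Fin d) := ⟨⟨0, by omega⟩⟩
  obtain ⟨i, hi⟩ := exists_eq_ciInf_of_finite (f := fun i : Fin d => (omega Rp κ)⁻¹ *
    ∫ x : Sph d, (1 - (x : E d) i) * ‖f x‖ ^ 2 ∂(wMeas Rp κ))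
  rw [← hi, hNΨ]
  simp only
  have hunci := hunc i
  set c := omega Rp κ
  set μ := wMeas Rp κ
  set N := ∫ x, ‖F x‖ ^ 2 ∂μ
  have hfsq : Integrable (fun x => ‖f x‖ ^ 2) μ := hfL.integrable_norm_pow two_ne_zero
  have hi1 : Integrable (fun x : Sph d => (x : E d) i * ‖f x‖ ^ 2) μ :=
    integrable_smul_of_continuous (by fun_prop) hfsq
  have hi2 : Integrable (fun x : Sph d => (x : E d) i ^ 2 * ‖f x‖ ^ 2) μ :=
    integrable_smul_of_continuous (by fun_prop) hfsq
  set a := ∫ x : Sph d, (x : E d) i * ‖f x‖ ^ 2 ∂μ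
  set b := ∫ x : Sph d, (x : E d) i ^ 2 * ‖f x‖ ^ 2 ∂μ
  have h1 : ∫ x : Sph d, (1 - (x : E d) i) * ‖f x‖ ^ 2 ∂μ = c - a := by
    simp only [sub_mul, one_mul]
    rw [integral_sub hfsq hi1, hfc]
  have h2 : ∫ x : Sph d, (1 - (x : E d) i ^ 2) * ‖f x‖ ^ 2 ∂μ = c - b := by
    simp only [sub_mul, one_mul]
    rw [integral_sub hfsq hi2, hfc]
  rw [h2] at hunci
  rw [h1]
  -- Nonnegative variance of `x_i` under the density `|f|²`; it lets `1 - α²` replace the mean of `1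
  -- - x_i²`.
  have hcs : a ^ 2 ≤ c * b := by
    have h3 : 0 ≤ ∫ x : Sph d, (c * (x : E d) i - a) ^ 2 * ‖f x‖ ^ 2 ∂μ :=
      integral_nonneg fun x => by positivity
    have h4 : ∫ x : Sph d, (c * (x : E d) i - a) ^ 2 * ‖f x‖ ^ 2 ∂μ =
        c ^ 2 * b - 2 * c * a * a + a ^ 2 * c := by
      have h5 : ∀ x : Sph d, (c * (x : E d) i - a) ^ 2 * ‖f x‖ ^ 2 =
          c ^ 2 * ((x : E d) i ^ 2 * ‖f x‖ ^ 2) - 2 * c * a * ((x : E d) i * ‖f x‖ ^ 2) +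
            a ^ 2 * ‖f x‖ ^ 2 := fun x => by ring
      have h6 : Integrable (fun x : Sph d => c ^ 2 * ((x : E d) i ^ 2 * ‖f x‖ ^ 2) -
          2 * c * a * ((x : E d) i * ‖f x‖ ^ 2)) μ := (hi2.const_mul _).sub (hi1.const_mul _)
      simp_rw [h5]
      rw [integral_add h6 (hfsq.const_mul _), integral_sub (hi2.const_mul _) (hi1.const_mul _),
        integral_const_mul, integral_const_mul, integral_const_mul, hfc]
    rw [h4] at h3
    by_contra! h5
    nlinarith
  have hN0 : 0 ≤ N := integral_nonneg fun x => by positivity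
  have hfin := uncertainty_scalar (L := lam Rp κ) (N := c⁻¹ * N) (α := c⁻¹ * a)
    (lam_nonneg hd hκ) ?_ ?_
  · have h3 : c⁻¹ * (c - a) * (c⁻¹ * N) = (1 - c⁻¹ * a) * (c⁻¹ * N) := by
      rw [mul_sub, inv_mul_cancel₀ hc.ne']
    rw [h3]
    exact hfin
  · rw [hfc] at hpoin
    rw [inv_mul_eq_div, le_div_iff₀ hc]
    exact hpoin
  · have h3 : c ^ 2 * ((lam Rp κ + 1 / 2) ^ 2 * (c⁻¹ * a) ^ 2) =
        ((lam Rp κ + 1 / 2) * a) ^ 2 := by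
      field_simp
    have h4 : c ^ 2 * (c⁻¹ * N * (1 - (c⁻¹ * a) ^ 2)) = N * (c - a ^ 2 / c) := by
      field_simp
    have h5 : a ^ 2 / c ≤ b := by
      rw [div_le_iff₀ hc]
      linarith
    refine le_of_mul_le_mul_left ?_ (by positivity : 0 < c ^ 2)
    rw [h3, h4]
    exact hunci.trans (mul_le_mul_of_nonneg_left (by linarith) hN0)
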